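/- A (real-valued) Lévy process is a process $X=(X(t))_{t\ge 0}$ with $X(0)=0$ almost surely, independent and stationary increments, and almost surely càdlàg paths; its Lévy measure $\Pi$ is the measure in the Lévy–Khintchine representation of the law of $X(1)$, that is, $\Pi(\{0\})=0$, $\int_{\mathbb R}\min(1,x^2)\,\Pi(\mathrm dx)<\infty$ and, for some $b\in\mathbb R$, $\sigma\ge 0$ and all $u\in\mathbb R$, \[ \mathbb E e^{iuX(1)}=\exp\Big(ibu-\tfrac12\sigma^2u^2+\int_{\mathbb R}\big(e^{iux}-1-iux\mathbf 1_{\{|x|\le 1\}}\big)\,\Pi(\mathrm dx)\Big). \] Put $\mu_4=\int_{\mathbb R}x^4\,\Pi(\mathrm dx)$ and, for an integer $k\ge1$, $X^{[k]}(t)=X(\lfloor kt\rfloor/k)$. There is a universal constant $C>0$ such that for every Lévy process $X$ (on any probability space) with \[ \mathbb E X(1)=0,\qquad \mathbb E X(1)^2=1,\qquad \mathbb E X(1)^4<\infty \] and for every integer $k\ge 2$, \[ \mathbb E\sup_{t\in[0,1]}\big(X(t)-X^{[k]}(t)\big)^2\le C\Big(k\mu_4+\frac{\log k}{k}\Big).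 \] -/

import Mathlib

open MeasureTheory ProbabilityTheory Filter Topology
open scoped NNReal ENNReal

/-- A real-valued Lévy process on the time set `[0, ∞)`: it starts at `0`, has independent and
stationary increments, and almost all its paths are right-continuous with left limits.
(Stochastic continuity follows from right-continuity and stationarity.) -/
structure IsLevyProcess {Ω : Type*} [MeasurableSpace Ω] (X : ℝ≥0 → Ω → ℝ) (P : Measure Ω) :
    Prop where
  aemeasurable : ∀ t, AEMeasurable (X t) P
  start_zero : ∀ᵐ ω ∂P, X 0 ω = 0
  indep_increments : HasIndepIncrements X P
  stationary_increments : ∀ s h : ℝ≥0, IdentDistrib (fun ω ↦ X (s + h) ω - X s ω) (X h) P P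
  cadlag : ∀ᵐ ω ∂P, ∀ t : ℝ≥0, ContinuousWithinAt (fun s ↦ X s ω) (Set.Ici t) t ∧
    ∃ l : ℝ, Tendsto (fun s ↦ X s ω) (𝓝[<] t) (𝓝 l)

/-- The Lévy–Khintchine representation: `ν` has no atom at `0`, integrates `min (1, x²)`, and
the characteristic function of `μ` is
`u ↦ exp (i b u - σ² u² / 2 + ∫ (exp (i u x) - 1 - i u x 1_{|x| ≤ 1}) ν(dx))`;
here `v` stands for `σ²`. -/
structure HasLevyTriplet (μ : Measure ℝ) (b : ℝ) (v : ℝ≥0) (ν : Measure ℝ) : Prop where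
  no_atom_zero : ν {0} = 0
  lintegral_min_lt_top : ∫⁻ x, ENNReal.ofReal (min 1 (x ^ 2)) ∂ν < ∞
  charFun_eq : ∀ u : ℝ, charFun μ u =
    Complex.exp (Complex.I * b * u - v * u ^ 2 / 2
      + ∫ x, (Complex.exp (Complex.I * u * x) - 1
          - Set.indicator (Set.Icc (-1 : ℝ) 1) (fun y : ℝ ↦ Complex.I * u * y) x) ∂ν)

open Classical in
/-- The Lévy measure of the process `X`: the measure in the Lévy–Khintchine representation of the
law of `X 1` (and `0` if the law of `X 1` has no such representation, which does not happen for a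
Lévy process). -/
noncomputable def levyMeasure {Ω : Type*} [MeasurableSpace Ω] (X : ℝ≥0 → Ω → ℝ) (P : Measure Ω) :
    Measure ℝ :=
  if h : ∃ ν : Measure ℝ, ∃ (b : ℝ) (v : ℝ≥0), HasLevyTriplet (P.map (X 1)) b v ν then h.choose
  else 0

/-- The fourth moment `∫ x⁴ Π(dx)` of the Lévy measure `Π` of `X`. -/
noncomputable def levyFourthMoment {Ω : Type*} [MeasurableSpace Ω] (X : ℝ≥0 → Ω → ℝ)
    (P : Measure Ω) : ℝ≥0∞ :=
  ∫⁻ x, ENNReal.ofReal (x ^ 4) ∂(levyMeasure X P)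

/-- The discretization `h^[k](t) = h(⌊k t⌋ / k)` of a function over the grid `{0, 1/k, 2/k, …}`. -/
noncomputable def discretize (k : ℕ) (h : ℝ≥0 → ℝ) (t : ℝ≥0) : ℝ :=
  h ((⌊(k : ℝ≥0) * t⌋₊ : ℝ≥0) / (k : ℝ≥0))

/-! ### Fourth moments of convolutions -/

section Moments

/-! Let `κ = E X(1)⁴ - 3` be the fourth cumulant. Two facts carry the theorem: the estimate with `κ`
in place of `μ₄`, and `κ ≤ μ₄`.

Paths. For any level `c ≥ 0`, a squared increment is at most `2c²` plus twice its squared overshoot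
over `c`. The overshoot `(|y| - c)₊` is convex, so Doob's inequality bounds its maximum on a grid
inside one block of length `1/k` by the overshoot of the full block increment. Summing over the `k`
blocks and refining the grids with Fatou's lemma gives `E sup ≤ 2c² + 8k E(|X(1/k)| - c)₊²`
(`IsLevyProcess.lintegral_iSup_sq_le`). If `kκ ≥ 1`, then `c = 0` suffices. Otherwise `c` is taken
of order `√(log k / k)`, and the overshoot must be shown to be of order `κ + 1/k²`.

Overshoot. Split `X(1/k)` into `100k` independent increments and replace them one at a time by
Gaussians of equal variance, testing against `(x - c)₊⁴`. The third derivative of this function is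
`24(x - c)₊`, so the third-moment error of a step is weighted by a mean overshoot. A crude bound on
that mean gives a first estimate of the fourth power; raising the level by `1/√k` turns this into a
much better bound on the mean, and a second pass gives the required order
(`integral_posPart_pow_four_le_of_semigroup`). The purely Gaussian overshoot is at most `24/k³`.

Cumulant. Symmetrising the law of `X(1)` makes its characteristic function real and removes the
drift; comparing expansions at `0` to order `u⁴` gives `κ ≤ μ₄` for every Lévy–Khintchine triplet
(`HasLevyTriplet.pow_four_moment_sub_three_le`). Hence uniqueness of the triplet is not needed.
Existence is, because `levyMeasure` defaults to `0`; it comes from a weak limit of the measures `n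
x² P(X(1/n) ∈ dx)` (`exists_hasLevyTriplet`). -/

lemma abs_pow_le_one_add_pow_four (x : ℝ) {j : ℕ} (hj : j ≤ 4) : |x| ^ j ≤ 1 + x ^ 4 := by
  have h4 : x ^ 4 = |x| ^ 4 := (Even.pow_abs (by decide) x).symm
  rw [h4]
  rcases le_total |x| 1 with h | h
  · have : |x| ^ j ≤ 1 := pow_le_one₀ (abs_nonneg x) h
    have : 0 ≤ |x| ^ 4 := by positivity
    linarith
  · have : |x| ^ j ≤ |x| ^ 4 := pow_le_pow_right₀ h hj
    linarith

variable {μ ν : Measure ℝ}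

lemma integrable_of_abs_le_pow_four [IsFiniteMeasure μ] (h : Integrable (fun x : ℝ ↦ x ^ 4) μ)
    {f : ℝ → ℝ} (hf : Measurable f) (C : ℝ) (hC : ∀ x, |f x| ≤ C * (1 + x ^ 4)) :
    Integrable f μ :=
  (((integrable_const (1 : ℝ)).add h).const_mul C).mono' hf.aestronglyMeasurable
    (ae_of_all _ fun x ↦ by simpa using hC x)

lemma integrable_pow_of_le_four [IsFiniteMeasure μ] (h : Integrable (fun x : ℝ ↦ x ^ 4) μ)
    {j : ℕ} (hj : j ≤ 4) : Integrable (fun x : ℝ ↦ x ^ j) μ :=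
  integrable_of_abs_le_pow_four h (by fun_prop) 1 fun x ↦ by
    rw [abs_pow, one_mul]; exact abs_pow_le_one_add_pow_four x hj

lemma integral_quartic [IsProbabilityMeasure μ] (h : Integrable (fun x : ℝ ↦ x ^ 4) μ)
    (a b c d e : ℝ) :
    ∫ x, (a + b * x + c * x ^ 2 + d * x ^ 3 + e * x ^ 4) ∂μ
      = a + b * ∫ x, x ∂μ + c * ∫ x, x ^ 2 ∂μ + d * ∫ x, x ^ 3 ∂μ + e * ∫ x, x ^ 4 ∂μ := by
  have j1 := integrable_pow_of_le_four h (j := 1) (by norm_num)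
  have j2 := integrable_pow_of_le_four h (j := 2) (by norm_num)
  have j3 := integrable_pow_of_le_four h (j := 3) (by norm_num)
  simp only [pow_one] at j1
  have k1 : Integrable (fun x ↦ a + b * x) μ := (integrable_const a).add (j1.const_mul b)
  have k2 : Integrable (fun x ↦ a + b * x + c * x ^ 2) μ := k1.add (j2.const_mul c)
  have k3 : Integrable (fun x ↦ a + b * x + c * x ^ 2 + d * x ^ 3) μ := k2.add (j3.const_mul d)
  rw [integral_add k3 (h.const_mul e), integral_add k2 (j3.const_mul d),
    integral_add k1 (j2.const_mul c), integral_add (integrable_const a) (j1.const_mul b)]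
  simp only [integral_const_mul, integral_const, probReal_univ, one_smul]
  rw [integral_const_mul b fun x ↦ x]

lemma add_pow_four_le (x y : ℝ) : (x + y) ^ 4 ≤ 8 * (x ^ 4 + y ^ 4) := by
  nlinarith [sq_nonneg (x - y), sq_nonneg (x ^ 2 - y ^ 2), sq_nonneg (x + y),
    mul_nonneg (sq_nonneg (x - y)) (sq_nonneg (x + y)),
    mul_nonneg (sq_nonneg (x - y)) (sq_nonneg (x - y)),
    mul_nonneg (sq_nonneg (x + y)) (sq_nonneg (x + y))]

lemma integrable_pow_four_conv [IsProbabilityMeasure μ] [IsProbabilityMeasure ν]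
    (hμ : Integrable (fun x : ℝ ↦ x ^ 4) μ) (hν : Integrable (fun x : ℝ ↦ x ^ 4) ν) :
    Integrable (fun x : ℝ ↦ x ^ 4) (μ ∗ ν) := by
  rw [Measure.conv, integrable_map_measure (by fun_prop) (by fun_prop)]
  refine (((hμ.comp_fst ν).add (hν.comp_snd μ)).const_mul 8).mono' (by fun_prop)
    (ae_of_all _ fun z ↦ ?_)
  simp only [Function.comp, Real.norm_eq_abs, Pi.add_apply]
  rw [abs_of_nonneg (by positivity)]
  exact add_pow_four_le _ _

/-- By Fubini some translate `x ↦ (a + x) ^ 4` is integrable, and `x = (a + x) - a`. This passes the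
fourth moment from time `1` to earlier times. -/
lemma integrable_pow_four_of_conv [IsProbabilityMeasure μ] [IsProbabilityMeasure ν]
    (h : Integrable (fun x : ℝ ↦ x ^ 4) (μ ∗ ν)) : Integrable (fun x : ℝ ↦ x ^ 4) ν := by
  rw [integrable_conv_iff (by fun_prop)] at h
  obtain ⟨a, ha⟩ := h.1.exists
  have := ha.const_mul 8 |>.add (integrable_const (8 * a ^ 4))
  refine this.mono' (by fun_prop) (ae_of_all _ fun x ↦ ?_)
  simp only [Real.norm_eq_abs, Pi.add_apply]
  rw [abs_of_nonneg (by positivity)]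
  have := add_pow_four_le (a + x) (-a)
  have e : a + x + -a = x := by ring
  rw [e] at this
  nlinarith [this]

lemma integral_conv_of_abs_le [IsProbabilityMeasure μ] [IsProbabilityMeasure ν]
    (hμ : Integrable (fun x : ℝ ↦ x ^ 4) μ) (hν : Integrable (fun x : ℝ ↦ x ^ 4) ν)
    {f : ℝ → ℝ} (hf : Measurable f) (C : ℝ) (hC : ∀ x, |f x| ≤ C * (1 + x ^ 4)) :
    ∫ x, f x ∂(μ ∗ ν) = ∫ x, ∫ y, f (x + y) ∂ν ∂μ :=
  integral_conv (integrable_of_abs_le_pow_four (integrable_pow_four_conv hμ hν) hf C hC)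

lemma integral_pow_conv [IsProbabilityMeasure μ] [IsProbabilityMeasure ν]
    (hμ : Integrable (fun x : ℝ ↦ x ^ 4) μ) (hν : Integrable (fun x : ℝ ↦ x ^ 4) ν)
    {j : ℕ} (hj : j ≤ 4) :
    ∫ x, x ^ j ∂(μ ∗ ν) = ∫ x, ∫ y, (x + y) ^ j ∂ν ∂μ :=
  integral_conv_of_abs_le hμ hν (by fun_prop) 1 fun x ↦ by
    rw [abs_pow, one_mul]; exact abs_pow_le_one_add_pow_four x hj

lemma integral_id_conv [IsProbabilityMeasure μ] [IsProbabilityMeasure ν]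
    (hμ : Integrable (fun x : ℝ ↦ x ^ 4) μ) (hν : Integrable (fun x : ℝ ↦ x ^ 4) ν) :
    ∫ x, x ∂(μ ∗ ν) = ∫ x, x ∂μ + ∫ x, x ∂ν := by
  have h := integral_pow_conv hμ hν (j := 1) (by norm_num)
  have i1 := integrable_pow_of_le_four hμ (j := 1) (by norm_num)
  have j1 := integrable_pow_of_le_four hν (j := 1) (by norm_num)
  simp only [pow_one] at h i1 j1
  rw [h]
  have : ∀ x : ℝ, ∫ y, (x + y) ∂ν = x + ∫ y, y ∂ν := fun x ↦ by
    rw [integral_add (integrable_const x) j1]; simp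
  simp_rw [this]
  rw [integral_add i1 (integrable_const _)]; simp

lemma integral_sq_conv [IsProbabilityMeasure μ] [IsProbabilityMeasure ν]
    (hμ : Integrable (fun x : ℝ ↦ x ^ 4) μ) (hν : Integrable (fun x : ℝ ↦ x ^ 4) ν)
    (hν1 : ∫ x, x ∂ν = 0) :
    ∫ x, x ^ 2 ∂(μ ∗ ν) = ∫ x, x ^ 2 ∂μ + ∫ x, x ^ 2 ∂ν := by
  rw [integral_pow_conv hμ hν (j := 2) (by norm_num)]
  have i2 := integrable_pow_of_le_four hμ (j := 2) (by norm_num)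
  have j1 := integrable_pow_of_le_four hν (j := 1) (by norm_num)
  have j2 := integrable_pow_of_le_four hν (j := 2) (by norm_num)
  simp only [pow_one] at j1
  have : ∀ x : ℝ, ∫ y, (x + y) ^ 2 ∂ν = x ^ 2 + ∫ y, y ^ 2 ∂ν := fun x ↦ by
    have e : ∀ y : ℝ, (x + y) ^ 2 = x ^ 2 + 2 * x * y + y ^ 2 := fun y ↦ by ring
    have := integral_quartic hν (x ^ 2) (2 * x) 1 0 0
    simp only [hν1, mul_zero, zero_mul, add_zero, one_mul] at this
    simp_rw [e, this]
  simp_rw [this]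
  rw [integral_add i2 (integrable_const _)]; simp

/-- Centring removes both terms containing a third moment, leaving only the mixed term `6 x² y²`. -/
lemma integral_pow_four_conv [IsProbabilityMeasure μ] [IsProbabilityMeasure ν]
    (hμ : Integrable (fun x : ℝ ↦ x ^ 4) μ) (hν : Integrable (fun x : ℝ ↦ x ^ 4) ν)
    (hμ1 : ∫ x, x ∂μ = 0) (hν1 : ∫ x, x ∂ν = 0) :
    ∫ x, x ^ 4 ∂(μ ∗ ν)
      = ∫ x, x ^ 4 ∂μ + 6 * (∫ x, x ^ 2 ∂μ) * (∫ x, x ^ 2 ∂ν) + ∫ x, x ^ 4 ∂ν := by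
  rw [integral_pow_conv hμ hν (j := 4) le_rfl]
  have i1 := integrable_pow_of_le_four hμ (j := 1) (by norm_num)
  have i2 := integrable_pow_of_le_four hμ (j := 2) (by norm_num)
  have j1 := integrable_pow_of_le_four hν (j := 1) (by norm_num)
  have j2 := integrable_pow_of_le_four hν (j := 2) (by norm_num)
  have j3 := integrable_pow_of_le_four hν (j := 3) (by norm_num)
  simp only [pow_one] at i1 j1
  have : ∀ x : ℝ, ∫ y, (x + y) ^ 4 ∂ν
      = x ^ 4 + 6 * (∫ y, y ^ 2 ∂ν) * x ^ 2 + 4 * (∫ y, y ^ 3 ∂ν) * x + ∫ y, y ^ 4 ∂ν := fun x ↦ by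
    have e : ∀ y : ℝ, (x + y) ^ 4
        = x ^ 4 + 4 * x ^ 3 * y + 6 * x ^ 2 * y ^ 2 + 4 * x * y ^ 3 + y ^ 4 := fun y ↦ by ring
    have := integral_quartic hν (x ^ 4) (4 * x ^ 3) (6 * x ^ 2) (4 * x) 1
    simp only [hν1, mul_zero, add_zero, one_mul] at this
    simp_rw [e, this]
    ring
  simp_rw [this]
  have e : ∀ x : ℝ, x ^ 4 + 6 * (∫ y, y ^ 2 ∂ν) * x ^ 2 + 4 * (∫ y, y ^ 3 ∂ν) * x + ∫ y, y ^ 4 ∂ν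
      = ∫ y, y ^ 4 ∂ν + 4 * (∫ y, y ^ 3 ∂ν) * x + 6 * (∫ y, y ^ 2 ∂ν) * x ^ 2 + 0 * x ^ 3
        + 1 * x ^ 4 := fun x ↦ by ring
  simp_rw [e]
  rw [integral_quartic hμ, hμ1]
  ring

lemma integrable_pow_four_map_neg (h : Integrable (fun x : ℝ ↦ x ^ 4) μ) :
    Integrable (fun x : ℝ ↦ x ^ 4) (μ.map fun x ↦ -x) := by
  rw [integrable_map_measure (by fun_prop) (by fun_prop)]
  refine h.congr (ae_of_all _ fun x ↦ ?_)
  simp only [Function.comp]; ring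

lemma integral_id_map_neg : ∫ x, x ∂(μ.map fun x ↦ -x) = -∫ x, x ∂μ := by
  rw [integral_map (by fun_prop) (by fun_prop), integral_neg]

lemma integral_pow_map_neg {j : ℕ} (hj : Even j) :
    ∫ x, x ^ j ∂(μ.map fun x ↦ -x) = ∫ x, x ^ j ∂μ := by
  rw [integral_map (by fun_prop) (by fun_prop)]
  simp only [hj.neg_pow]

/-- Cauchy–Schwarz for the third moment. -/
lemma abs_integral_pow_three_le [IsProbabilityMeasure μ] (h : Integrable (fun x : ℝ ↦ x ^ 4) μ) :
    |∫ x, x ^ 3 ∂μ| ≤ √((∫ x, x ^ 2 ∂μ) * ∫ x, x ^ 4 ∂μ) := by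
  have i2 := integrable_pow_of_le_four h (j := 2) (by norm_num)
  have i3 := integrable_pow_of_le_four h (j := 3) (by norm_num)
  apply Real.abs_le_sqrt
  set a := ∫ x, x ^ 2 ∂μ
  set b := ∫ x, x ^ 3 ∂μ
  set d := ∫ x, x ^ 4 ∂μ
  have ha : 0 ≤ a := integral_nonneg fun x ↦ by positivity
  have hq : ∀ t : ℝ, 0 ≤ a * (t * t) + (2 * b) * t + d := fun t ↦ by
    have : ∫ x, (t * x + x ^ 2) ^ 2 ∂μ = a * (t * t) + (2 * b) * t + d := by
      have e : ∀ x : ℝ, (t * x + x ^ 2) ^ 2 = t * t * x ^ 2 + 2 * t * x ^ 3 + x ^ 4 :=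
        fun x ↦ by ring
      have := integral_quartic h 0 0 (t * t) (2 * t) 1
      simp only [zero_mul, zero_add, one_mul] at this
      simp_rw [e, this]
      ring
    rw [← this]
    exact integral_nonneg fun x ↦ by positivity
  have := discrim_le_zero hq
  simp only [discrim] at this
  nlinarith

lemma integral_abs_le_sqrt [IsProbabilityMeasure μ] (h : Integrable (fun x : ℝ ↦ x ^ 4) μ) :
    ∫ x, |x| ∂μ ≤ √(∫ x, x ^ 2 ∂μ) := by
  have i1 := (integrable_pow_of_le_four h (j := 1) (by norm_num)).abs
  have i2 := integrable_pow_of_le_four h (j := 2) (by norm_num)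
  simp only [pow_one] at i1
  apply Real.le_sqrt_of_sq_le
  set m := ∫ x, |x| ∂μ
  have : 0 ≤ ∫ x, (|x| - m) ^ 2 ∂μ := integral_nonneg fun x ↦ by positivity
  have e : ∀ x : ℝ, (|x| - m) ^ 2 = x ^ 2 - 2 * m * |x| + m ^ 2 := fun x ↦ by
    rw [← sq_abs x]; ring
  simp_rw [e] at this
  have i3 : Integrable (fun x ↦ x ^ 2 - 2 * m * |x|) μ := i2.sub (i1.const_mul _)
  rw [integral_add i3 (integrable_const _), integral_sub i2 (i1.const_mul _), integral_const_mul] at this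
  simp only [integral_const, probReal_univ, one_smul] at this
  change 0 ≤ (∫ x, x ^ 2 ∂μ) - 2 * m * m + m ^ 2 at this
  nlinarith

end Moments

/-! ### Lindeberg replacement for the function `x ↦ (x - c)₊ ^ 4` -/

section Lindeberg

variable {ρ α β : Measure ℝ}

/-- Third order Taylor expansion of `y ↦ y₊ ^ 4`. -/
lemma abs_posPart_pow_four_taylor_le (y h : ℝ) :
    |(max (y + h) 0) ^ 4 - ((max y 0) ^ 4 + 4 * (max y 0) ^ 3 * h + 6 * (max y 0) ^ 2 * h ^ 2
      + 4 * (max y 0) * h ^ 3)| ≤ h ^ 4 := by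
  rcases le_total 0 y with hy | hy <;> rcases le_total 0 (y + h) with hz | hz
  · rw [max_eq_left hy, max_eq_left hz]
    have : (y + h) ^ 4 - (y ^ 4 + 4 * y ^ 3 * h + 6 * y ^ 2 * h ^ 2 + 4 * y * h ^ 3) = h ^ 4 := by
      ring
    rw [this, abs_of_nonneg (by positivity)]
  · rw [max_eq_left hy, max_eq_right hz]
    -- Here `0 ≤ y ≤ -h`, so `(y + h) ^ 4` lies between `0` and `h ^ 4`.
    have : (0 : ℝ) ^ 4 - (y ^ 4 + 4 * y ^ 3 * h + 6 * y ^ 2 * h ^ 2 + 4 * y * h ^ 3)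
        = h ^ 4 - (y + h) ^ 4 := by ring
    rw [this, abs_le]
    have h1 : (-(y + h)) ^ 4 ≤ (-h) ^ 4 := pow_le_pow_left₀ (by linarith) (by linarith) 4
    have e1 : (-(y + h)) ^ 4 = (y + h) ^ 4 := by ring
    have e2 : (-h) ^ 4 = h ^ 4 := by ring
    have : 0 ≤ (y + h) ^ 4 := by positivity
    constructor <;> nlinarith [sq_nonneg (h ^ 2)]
  · rw [max_eq_right hy, max_eq_left hz]
    have h1 : (y + h) ^ 4 ≤ h ^ 4 := pow_le_pow_left₀ hz (by linarith) 4
    have : 0 ≤ (y + h) ^ 4 := by positivity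
    rw [abs_of_nonneg (by simpa using this)]
    simpa using h1
  · rw [max_eq_right hy, max_eq_right hz]
    simp only [ne_eq, OfNat.ofNat_ne_zero, not_false_eq_true, zero_pow, mul_zero, zero_mul,
      add_zero, sub_zero, abs_zero]
    positivity

lemma max_zero_pow_four_le (y : ℝ) : (max y 0) ^ 4 ≤ y ^ 4 := by
  rcases le_total 0 y with hy | hy
  · rw [max_eq_left hy]
  · rw [max_eq_right hy]; simp; positivity

lemma abs_posPart_pow_four_le (z x : ℝ) :
    |(max (z + x) 0) ^ 4| ≤ 8 * (1 + z ^ 4) * (1 + x ^ 4) := by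
  rw [abs_of_nonneg (by positivity)]
  have h1 := max_zero_pow_four_le (z + x)
  have h2 := add_pow_four_le z x
  have h3 : 0 ≤ z ^ 4 * x ^ 4 := by positivity
  nlinarith

lemma integrable_posPart_pow_four [IsFiniteMeasure α] (h : Integrable (fun x : ℝ ↦ x ^ 4) α)
    (z : ℝ) : Integrable (fun x : ℝ ↦ (max (z + x) 0) ^ 4) α :=
  integrable_of_abs_le_pow_four h (by fun_prop) _ (abs_posPart_pow_four_le z)

lemma integrable_posPart {μ : Measure ℝ} [IsFiniteMeasure μ]
    (h : Integrable (fun x : ℝ ↦ x ^ 4) μ) (c : ℝ) : Integrable (fun x ↦ max (x - c) 0) μ := by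
  refine integrable_of_abs_le_pow_four h (by fun_prop) (1 + |c|) fun x ↦ ?_
  rw [abs_of_nonneg (le_max_right _ _)]
  have h0 := abs_pow_le_one_add_pow_four x (j := 1) (by norm_num)
  have h4 : 0 ≤ x ^ 4 := by positivity
  have hc := abs_nonneg c
  refine max_le ?_ (by positivity)
  nlinarith [le_abs_self x, neg_abs_le c, mul_nonneg hc h4]

/-- One replacement step, conditionally on the remaining summands. -/
lemma abs_integral_posPart_pow_four_sub_le [IsProbabilityMeasure α]
    (h : Integrable (fun x : ℝ ↦ x ^ 4) α) (h1 : ∫ x, x ∂α = 0) (z : ℝ) :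
    |∫ x, (max (z + x) 0) ^ 4 ∂α - ((max z 0) ^ 4 + 6 * (max z 0) ^ 2 * ∫ x, x ^ 2 ∂α
      + 4 * (max z 0) * ∫ x, x ^ 3 ∂α)| ≤ ∫ x, x ^ 4 ∂α := by
  have j1 := integrable_pow_of_le_four h (j := 1) (by norm_num)
  have j2 := integrable_pow_of_le_four h (j := 2) (by norm_num)
  have j3 := integrable_pow_of_le_four h (j := 3) (by norm_num)
  simp only [pow_one] at j1
  set w := max z 0
  have iT : Integrable (fun x ↦ w ^ 4 + 4 * w ^ 3 * x + 6 * w ^ 2 * x ^ 2 + 4 * w * x ^ 3) α :=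
    (((integrable_const _).add (j1.const_mul _)).add (j2.const_mul _)).add (j3.const_mul _)
  have e : ∫ x, (w ^ 4 + 4 * w ^ 3 * x + 6 * w ^ 2 * x ^ 2 + 4 * w * x ^ 3) ∂α
      = w ^ 4 + 6 * w ^ 2 * ∫ x, x ^ 2 ∂α + 4 * w * ∫ x, x ^ 3 ∂α := by
    have := integral_quartic h (w ^ 4) (4 * w ^ 3) (6 * w ^ 2) (4 * w) 0
    simp only [h1, mul_zero, zero_mul, add_zero] at this
    exact this
  rw [← e, ← integral_sub (integrable_posPart_pow_four h z) iT]
  refine (abs_integral_le_integral_abs).trans ?_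
  exact integral_mono ((integrable_posPart_pow_four h z).sub iT).abs h
    (fun x ↦ abs_posPart_pow_four_taylor_le z x)

/-- One step of the Lindeberg replacement: exchanging the summand `β` (with vanishing third
moment) for `α`. -/
lemma integral_posPart_pow_four_conv_le [IsProbabilityMeasure ρ] [IsProbabilityMeasure α]
    [IsProbabilityMeasure β] (hρ : Integrable (fun x : ℝ ↦ x ^ 4) ρ)
    (hα : Integrable (fun x : ℝ ↦ x ^ 4) α) (hβ : Integrable (fun x : ℝ ↦ x ^ 4) β)
    (hα1 : ∫ x, x ∂α = 0) (hβ1 : ∫ x, x ∂β = 0) (h2 : ∫ x, x ^ 2 ∂α = ∫ x, x ^ 2 ∂β)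
    (hβ3 : ∫ x, x ^ 3 ∂β = 0) (c : ℝ) :
    ∫ x, (max (x - c) 0) ^ 4 ∂(ρ ∗ α) ≤ ∫ x, (max (x - c) 0) ^ 4 ∂(ρ ∗ β)
      + 4 * |∫ x, x ^ 3 ∂α| * ∫ x, max (x - c) 0 ∂ρ + ∫ x, x ^ 4 ∂α + ∫ x, x ^ 4 ∂β := by
  have hb : ∀ x : ℝ, |(max (x - c) 0) ^ 4| ≤ 8 * (1 + (-c) ^ 4) * (1 + x ^ 4) := fun x ↦ by
    have := abs_posPart_pow_four_le (-c) x
    rwa [neg_add_eq_sub] at this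
  have hm : Measurable fun x : ℝ ↦ (max (x - c) 0) ^ 4 := by fun_prop
  have key : ∀ γ : Measure ℝ, IsProbabilityMeasure γ → Integrable (fun x : ℝ ↦ x ^ 4) γ →
      ∫ x, (max (x - c) 0) ^ 4 ∂(ρ ∗ γ) = ∫ x, ∫ y, (max ((x - c) + y) 0) ^ 4 ∂γ ∂ρ ∧
      Integrable (fun x ↦ ∫ y, (max ((x - c) + y) 0) ^ 4 ∂γ) ρ := fun γ _ hγ ↦ by
    have e : ∀ x y : ℝ, (max ((x - c) + y) 0) ^ 4 = (max (x + y - c) 0) ^ 4 := fun x y ↦ by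
      rw [sub_add_eq_add_sub]
    simp_rw [e]
    refine ⟨integral_conv_of_abs_le hρ hγ hm _ hb, ?_⟩
    have := integrable_of_abs_le_pow_four (integrable_pow_four_conv hρ hγ) hm _ hb
    rw [integrable_conv_iff (by fun_prop)] at this
    refine this.2.congr (ae_of_all _ fun x ↦ integral_congr_ae (ae_of_all _ fun y ↦ ?_))
    simp only [Real.norm_eq_abs]
    rw [abs_of_nonneg (by positivity)]
  obtain ⟨eα, iα⟩ := key α inferInstance hα
  obtain ⟨eβ, iβ⟩ := key β inferInstance hβ
  have i1 := integrable_posPart hρ c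
  rw [eα, eβ, ← integral_const_mul]
  have : ∀ x, ∫ y, (max ((x - c) + y) 0) ^ 4 ∂α ≤ ∫ y, (max ((x - c) + y) 0) ^ 4 ∂β
      + 4 * |∫ x, x ^ 3 ∂α| * max (x - c) 0 + (∫ x, x ^ 4 ∂α + ∫ x, x ^ 4 ∂β) := fun x ↦ by
    have a1 := (abs_le.1 (abs_integral_posPart_pow_four_sub_le hα hα1 (x - c))).2
    have b1 := (abs_le.1 (abs_integral_posPart_pow_four_sub_le hβ hβ1 (x - c))).1
    rw [hβ3] at b1
    rw [h2] at a1
    have h3 : (max (x - c) 0) * ∫ x, x ^ 3 ∂α ≤ (max (x - c) 0) * |∫ x, x ^ 3 ∂α| :=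
      mul_le_mul_of_nonneg_left (le_abs_self _) (le_max_right _ _)
    nlinarith
  refine (integral_mono iα ((iβ.add (i1.const_mul _)).add (integrable_const _)) this).trans_eq ?_
  have s1 := integral_add (iβ.add (i1.const_mul (4 * |∫ x, x ^ 3 ∂α|)))
    (integrable_const (μ := ρ) (∫ x, x ^ 4 ∂α + ∫ x, x ^ 4 ∂β))
  have s2 := integral_add iβ (i1.const_mul (4 * |∫ x, x ^ 3 ∂α|))
  simp only [Pi.add_apply] at s1 s2 ⊢
  rw [s1, s2]
  simp
  ring

end Lindeberg

/-! ### Gaussian moments and overshoots. -/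

section Gaussian

lemma integrable_pow_four_gaussianReal (v : ℝ≥0) :
    Integrable (fun x : ℝ ↦ x ^ 4) (gaussianReal 0 v) := by
  have := (memLp_id_gaussianReal (μ := 0) (v := v) 4).integrable_norm_pow (p := 4) (by norm_num)
  refine this.congr (ae_of_all _ fun x ↦ ?_)
  simp [Even.pow_abs (show Even 4 by decide)]

lemma integral_sq_gaussianReal (v : ℝ≥0) : ∫ x, x ^ 2 ∂(gaussianReal 0 v) = v := by
  have h := variance_id_gaussianReal (μ := 0) (v := v)
  rw [variance_of_integral_eq_zero aemeasurable_id (by simp)] at h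
  simpa using h

lemma integral_pow_three_gaussianReal (v : ℝ≥0) : ∫ x, x ^ 3 ∂(gaussianReal 0 v) = 0 := by
  have h : ∫ x, x ^ 3 ∂((gaussianReal 0 v).map (fun x ↦ -x)) = ∫ x, x ^ 3 ∂(gaussianReal 0 v) := by
    rw [gaussianReal_map_neg, neg_zero]
  rw [integral_map (by fun_prop) (by fun_prop)] at h
  have e : ∀ x : ℝ, (-x) ^ 3 = -(x ^ 3) := fun x ↦ by ring
  simp_rw [e] at h
  rw [integral_neg] at h
  linarith

/-- For `y ≥ 0`, keep only the term `(l y)⁴ / 4!` of the exponential series. -/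
lemma max_zero_pow_four_le_exp (l y : ℝ) (hl : 0 < l) :
    (max y 0) ^ 4 ≤ 24 / l ^ 4 * Real.exp (l * y) := by
  rcases le_total y 0 with hy | hy
  · rw [max_eq_right hy]
    have := Real.exp_pos (l * y)
    rw [zero_pow (by norm_num)]
    positivity
  · rw [max_eq_left hy]
    have := Real.pow_div_factorial_le_exp (l * y) (by positivity) 4
    have e : ((Nat.factorial 4 : ℕ) : ℝ) = 24 := by norm_num [Nat.factorial]
    rw [e, div_le_iff₀ (by norm_num), mul_pow] at this
    rw [div_mul_eq_mul_div, le_div_iff₀ (by positivity)]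
    linarith

/-- A Chernoff bound; the parameter `l` stays free and is chosen differently in its two uses. -/
lemma integral_posPart_pow_four_gaussianReal_le_exp (v : ℝ≥0) (c l : ℝ) (hl : 0 < l) :
    ∫ x, (max (x - c) 0) ^ 4 ∂(gaussianReal 0 v)
      ≤ 24 / l ^ 4 * Real.exp (v * l ^ 2 / 2 - l * c) := by
  have hi : Integrable (fun x ↦ (max (x - c) 0) ^ 4) (gaussianReal 0 v) := by
    have := integrable_posPart_pow_four (integrable_pow_four_gaussianReal v) (-c)
    simpa only [neg_add_eq_sub] using this
  have hm := congrFun (mgf_id_gaussianReal (μ := 0) (v := v)) l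
  simp only [mgf, id_eq, zero_mul, zero_add] at hm
  have hexp : Integrable (fun x ↦ Real.exp (l * x)) (gaussianReal 0 v) :=
    integrable_exp_mul_gaussianReal l
  calc ∫ x, (max (x - c) 0) ^ 4 ∂(gaussianReal 0 v)
      ≤ ∫ x, 24 / l ^ 4 * Real.exp (-(l * c)) * Real.exp (l * x) ∂(gaussianReal 0 v) := by
        refine integral_mono hi (hexp.const_mul _) fun x ↦ ?_
        refine (max_zero_pow_four_le_exp l (x - c) hl).trans_eq ?_
        rw [mul_assoc, ← Real.exp_add]
        ring_nf
    _ = _ := by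
        rw [integral_const_mul, hm, mul_assoc, ← Real.exp_add]
        ring_nf

/-- The exponential bound with `c = 0` and `l = 1 / √v` gives `24 v² exp (1/2) ≤ 48 v²` on each
half-line. The constant is crude, which the choice of mesh later absorbs. -/
lemma integral_pow_four_gaussianReal_le (v : ℝ≥0) (hv : 0 < v) :
    ∫ x, x ^ 4 ∂(gaussianReal 0 v) ≤ 96 * (v : ℝ) ^ 2 := by
  have hv' : (0 : ℝ) < v := hv
  have hs : (0 : ℝ) < √v := Real.sqrt_pos.2 hv'
  have hl : (0 : ℝ) < 1 / √v := by positivity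
  have h1 := integral_posPart_pow_four_gaussianReal_le_exp v 0 (1 / √v) hl
  simp only [sub_zero, mul_zero] at h1
  have s2 : (√(v : ℝ)) ^ 2 = v := Real.sq_sqrt hv'.le
  have s4 : (√(v : ℝ)) ^ 4 = v ^ 2 := by
    rw [show (4 : ℕ) = 2 * 2 from rfl, pow_mul, s2]
  have e1 : (v : ℝ) * (1 / √v) ^ 2 / 2 = 1 / 2 := by
    rw [div_pow, s2]; field_simp
  have e2 : 24 / (1 / √(v : ℝ)) ^ 4 = 24 * (v : ℝ) ^ 2 := by
    rw [div_pow, s4]; field_simp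
  rw [e1, e2] at h1
  have hexp : Real.exp (1 / 2) ≤ 2 := by
    have h := Real.exp_one_lt_d9
    have : Real.exp (1 / 2) ^ 2 = Real.exp 1 := by rw [← Real.exp_nat_mul]; norm_num
    nlinarith [Real.exp_pos (1 / 2)]
  have hi : Integrable (fun x ↦ (max x 0) ^ 4) (gaussianReal 0 v) := by
    simpa using integrable_posPart_pow_four (integrable_pow_four_gaussianReal v) 0
  have hneg : ∫ x, (max (-x) 0) ^ 4 ∂(gaussianReal 0 v) = ∫ x, (max x 0) ^ 4 ∂(gaussianReal 0 v) := by
    conv_rhs => rw [← neg_zero, ← gaussianReal_map_neg]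
    rw [integral_map (by fun_prop) (by fun_prop)]
    simp
  have hi' : Integrable (fun x ↦ (max (-x) 0) ^ 4) (gaussianReal 0 v) :=
    integrable_of_abs_le_pow_four (integrable_pow_four_gaussianReal v) (by fun_prop) 1 fun x ↦ by
      rw [abs_of_nonneg (by positivity)]
      have := max_zero_pow_four_le (-x)
      have e : (-x) ^ 4 = x ^ 4 := by ring
      linarith
  have e3 : ∀ x : ℝ, x ^ 4 = (max x 0) ^ 4 + (max (-x) 0) ^ 4 := fun x ↦ by
    rcases le_total x 0 with h | h
    · rw [max_eq_right h, max_eq_left (by linarith)]; ring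
    · rw [max_eq_left h, max_eq_right (by linarith)]; ring
  rw [integral_congr_ae (ae_of_all _ e3), integral_add hi hi', hneg]
  nlinarith [sq_nonneg (v : ℝ)]

/-- The fourth moment of the overshoot of a Gaussian variable of variance at most `1 / k` over the
level `√(2 log k / k)`. -/
lemma integral_posPart_pow_four_gaussianReal_le {v : ℝ≥0} {k : ℕ} (hk : 2 ≤ k)
    (hv : (v : ℝ) ≤ 1 / k) {r : ℝ} (hr0 : 0 < r) (hr2 : r ^ 2 = 1 / k) :
    ∫ x, (max (x - √(2 * Real.log k) * r) 0) ^ 4 ∂(gaussianReal 0 v) ≤ 24 * r ^ 6 := by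
  have hk0 : (0 : ℝ) < k := by positivity
  have hlog : 0 < Real.log k := Real.log_pos (by exact_mod_cast (by omega : 1 < k))
  have hlog2 : 1 ≤ 2 * Real.log k := by
    have h1 := Real.log_two_gt_d9
    have h2 : Real.log 2 ≤ Real.log k := Real.log_le_log (by norm_num) (by exact_mod_cast hk)
    linarith
  have hL1 : 1 ≤ √(2 * Real.log k) := Real.one_le_sqrt.2 hlog2
  have hcr : r ≤ √(2 * Real.log k) * r := le_mul_of_one_le_left hr0.le hL1
  have ec : (√(2 * Real.log k) * r) ^ 2 * k = 2 * Real.log k := by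
    rw [mul_pow, Real.sq_sqrt (by positivity), hr2]; field_simp
  generalize √(2 * Real.log k) * r = c at hcr ec ⊢
  have hc0 : 0 < c := hr0.trans_le hcr
  have hl : 0 < c * k := by positivity
  -- For variance `1 / k` the exponent `v l² / 2 - l c` is minimal at `l = c k`, with value `-c² k /
  -- 2 = -log k`.
  refine (integral_posPart_pow_four_gaussianReal_le_exp v c (c * k) hl).trans ?_
  have e1 : (v : ℝ) * (c * k) ^ 2 / 2 - c * k * c ≤ - Real.log k := by
    have h : (v : ℝ) * (c * k) ^ 2 ≤ 1 / k * (c * k) ^ 2 := by gcongr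
    have e : 1 / k * (c * k) ^ 2 = c ^ 2 * k := by field_simp
    have e' : c * k * c = c ^ 2 * k := by ring
    rw [e, ec] at h
    rw [e', ec]
    linarith
  have e2 : Real.exp (- Real.log k) = r ^ 2 := by
    rw [Real.exp_neg, Real.exp_log hk0, hr2, one_div]
  have e3 : 24 / (c * k) ^ 4 ≤ 24 * r ^ 4 := by
    have : (r * k) ^ 4 ≤ (c * k) ^ 4 := by gcongr
    have e : 24 / (r * k) ^ 4 = 24 * r ^ 4 := by
      have : (k : ℝ) = 1 / r ^ 2 := by rw [hr2]; field_simp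
      rw [this]; field_simp
    rw [← e]; gcongr
  calc _ ≤ 24 * r ^ 4 * Real.exp (- Real.log k) := by gcongr
    _ = 24 * r ^ 6 := by rw [e2]; ring

end Gaussian

/-! ### Iterated replacement and the two-pass bound. -/

section Iteration

variable {A B : ℕ → Measure ℝ}

/-- The Lindeberg replacement along two convolution semigroups. -/
lemma integral_posPart_pow_four_conv_le_of_semigroup [∀ i, IsProbabilityMeasure (A i)]
    [∀ i, IsProbabilityMeasure (B i)]
    (hA4 : ∀ i, Integrable (fun x : ℝ ↦ x ^ 4) (A i))
    (hB4 : ∀ i, Integrable (fun x : ℝ ↦ x ^ 4) (B i))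
    (hA0 : A 0 = Measure.dirac 0) (hA : ∀ i, A (i + 1) = A i ∗ A 1)
    (hB : ∀ i, B (i + 1) = B i ∗ B 1)
    (hA1 : ∫ x, x ∂(A 1) = 0) (hB1 : ∫ x, x ∂(B 1) = 0)
    (h2 : ∫ x, x ^ 2 ∂(A 1) = ∫ x, x ^ 2 ∂(B 1)) (hB3 : ∫ x, x ^ 3 ∂(B 1) = 0)
    {c K : ℝ} {M : ℕ} (hK : ∀ i j, i + j < M → ∫ x, max (x - c) 0 ∂(A i ∗ B j) ≤ K) (i : ℕ) :
    ∀ j, i + j ≤ M → ∫ x, (max (x - c) 0) ^ 4 ∂(A i ∗ B j) ≤ ∫ x, (max (x - c) 0) ^ 4 ∂(B (i + j))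
      + i * (4 * |∫ x, x ^ 3 ∂(A 1)| * K + ∫ x, x ^ 4 ∂(A 1) + ∫ x, x ^ 4 ∂(B 1)) := by
  induction i with
  | zero =>
    intro j _
    rw [hA0, Measure.dirac_zero_conv]
    simp
  | succ i ih =>
    intro j hj
    -- Commutativity moves the summand to be exchanged to the end, so the remaining sum `A i ∗ B j`
    -- plays the role of `ρ`.
    have e1 : A (i + 1) ∗ B j = (A i ∗ B j) ∗ A 1 := by
      rw [hA, Measure.conv_assoc, Measure.conv_comm (A 1), ← Measure.conv_assoc]
    have e2 : (A i ∗ B j) ∗ B 1 = A i ∗ B (j + 1) := by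
      rw [hB j, Measure.conv_assoc]
    have h := integral_posPart_pow_four_conv_le (ρ := A i ∗ B j)
      (integrable_pow_four_conv (hA4 i) (hB4 j)) (hA4 1) (hB4 1) hA1 hB1 h2 hB3 c
    have ih' := ih (j + 1) (by omega)
    have hk := mul_le_mul_of_nonneg_left (hK i j (by omega))
      (show 0 ≤ 4 * |∫ x, x ^ 3 ∂(A 1)| by positivity)
    rw [e1]
    rw [e2] at h
    rw [show i + 1 + j = i + (j + 1) by ring]
    push_cast
    linarith

lemma integral_id_semigroup [∀ i, IsProbabilityMeasure (A i)]
    (hA4 : ∀ i, Integrable (fun x : ℝ ↦ x ^ 4) (A i))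
    (hA0 : A 0 = Measure.dirac 0) (hA : ∀ i, A (i + 1) = A i ∗ A 1) (i : ℕ) :
    ∫ x, x ∂(A i) = i * ∫ x, x ∂(A 1) := by
  induction i with
  | zero => simp [hA0]
  | succ i ih =>
    rw [hA, integral_id_conv (hA4 i) (hA4 1), ih]
    push_cast; ring

lemma integral_sq_semigroup [∀ i, IsProbabilityMeasure (A i)]
    (hA4 : ∀ i, Integrable (fun x : ℝ ↦ x ^ 4) (A i))
    (hA0 : A 0 = Measure.dirac 0) (hA : ∀ i, A (i + 1) = A i ∗ A 1) (hA1 : ∫ x, x ∂(A 1) = 0)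
    (i : ℕ) : ∫ x, x ^ 2 ∂(A i) = i * ∫ x, x ^ 2 ∂(A 1) := by
  induction i with
  | zero => simp [hA0]
  | succ i ih =>
    rw [hA, integral_sq_conv (hA4 i) (hA4 1) hA1, ih]
    push_cast; ring

/-- Equivalently, the cumulant `m₄ - 3 m₂²` is additive along the semigroup. -/
lemma integral_pow_four_semigroup [∀ i, IsProbabilityMeasure (A i)]
    (hA4 : ∀ i, Integrable (fun x : ℝ ↦ x ^ 4) (A i))
    (hA0 : A 0 = Measure.dirac 0) (hA : ∀ i, A (i + 1) = A i ∗ A 1) (hA1 : ∫ x, x ∂(A 1) = 0)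
    (i : ℕ) : ∫ x, x ^ 4 ∂(A i)
      = i * ∫ x, x ^ 4 ∂(A 1) + 3 * i * (i - 1) * (∫ x, x ^ 2 ∂(A 1)) ^ 2 := by
  induction i with
  | zero => simp [hA0]
  | succ i ih =>
    have h1 : ∫ x, x ∂(A i) = 0 := by rw [integral_id_semigroup hA4 hA0 hA, hA1, mul_zero]
    rw [hA, integral_pow_four_conv (hA4 i) (hA4 1) h1 hA1, ih,
      integral_sq_semigroup hA4 hA0 hA hA1 i]
    push_cast; ring

/-- Closing arithmetic of the second pass, with `r = 1 / √k` and `q = κ + 1 / k²`. The products `√q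
r³`, `√q √q` and `√q q / r` are all of order `q`; the constants add up to `24 + 96 + 16 + 6 + 1 =
143`. -/
lemma overshoot_bound_le {r q : ℝ} (hr0 : 0 < r) (hr1 : r ^ 2 ≤ 1) (hq0 : 0 < q)
    (hqr : q ≤ 2 * r ^ 2) (hq4 : r ^ 4 ≤ q) :
    24 * r ^ 6 + r ^ 2 * (4 * √q * (24 * r ^ 3 + 4 * √q + q / r) + q) ≤ 143 * q * r ^ 2 := by
  have hs0 : 0 ≤ √q := Real.sqrt_nonneg q
  have hsq : √q ^ 2 = q := Real.sq_sqrt hq0.le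
  have hsr : √q ≤ 3 / 2 * r := by
    apply Real.sqrt_le_iff.2 ⟨by positivity, ?_⟩
    nlinarith [sq_nonneg r]
  have hr1' : r ≤ 1 := by nlinarith
  have e2 : √q * (q / r) ≤ 3 / 2 * q := by
    calc √q * (q / r) ≤ 3 / 2 * r * (q / r) := by gcongr
      _ = _ := by field_simp
  have e3 : √q * r ^ 3 ≤ q := by
    have h2 : r ^ 2 ≤ √q := Real.le_sqrt_of_sq_le (by rw [← pow_mul]; exact hq4)
    calc √q * r ^ 3 = √q * (r ^ 2 * r) := by ring
      _ ≤ √q * (√q * 1) := by gcongr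
      _ = q := by rw [mul_one, ← sq, hsq]
  have e4 : 4 * √q * (24 * r ^ 3 + 4 * √q + q / r) + q ≤ 119 * q := by
    have : 4 * √q * (24 * r ^ 3 + 4 * √q + q / r) + q
        = 96 * (√q * r ^ 3) + 16 * √q ^ 2 + 4 * (√q * (q / r)) + q := by ring
    rw [this, hsq]
    linarith
  calc _ ≤ 24 * (r ^ 2 * q) + r ^ 2 * (119 * q) := by
        have e1 : r ^ 6 ≤ r ^ 2 * q := by
          have : r ^ 6 = r ^ 2 * r ^ 4 := by ring
          rw [this]; gcongr
        gcongr
    _ = _ := by ring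

set_option maxHeartbeats 800000 in
/-- The fourth moment of the overshoot over a level of order `√(log k / k)`, for the convolution
semigroup of a centred law with variance `1 / k` at time `m` and with small fourth cumulant. -/
lemma integral_posPart_pow_four_le_of_semigroup [∀ i, IsProbabilityMeasure (A i)]
    (hA4 : ∀ i, Integrable (fun x : ℝ ↦ x ^ 4) (A i))
    (hA0 : A 0 = Measure.dirac 0) (hA : ∀ i, A (i + 1) = A i ∗ A 1)
    (hA1 : ∫ x, x ∂(A 1) = 0) {k m : ℕ} (hk : 2 ≤ k) (hm : m = 100 * k)
    (h2 : ∫ x, x ^ 2 ∂(A 1) = 1 / (m * k)) {κ : ℝ} (hκ : 0 ≤ κ) (hκk : k * κ ≤ 1)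
    (h4 : ∫ x, x ^ 4 ∂(A 1) = (κ + 3 / (m * k)) / (m * k)) {r c : ℝ} (hr : r = 1 / √k)
    (hc : c = (1 + √(2 * Real.log k)) * r) :
    ∫ x, (max (x - c) 0) ^ 4 ∂(A m) ≤ 143 * (κ + 1 / k ^ 2) / k := by
  have hk0 : (0 : ℝ) < k := by positivity
  have hm0 : (0 : ℝ) < m := by rw [hm]; positivity
  have hr0 : 0 < r := by rw [hr]; positivity
  have hr2 : r ^ 2 = 1 / k := by rw [hr, div_pow, Real.sq_sqrt hk0.le, one_pow]
  set n : ℝ := m * k with hn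
  have hn0 : 0 < n := by positivity
  have hmn : (m : ℝ) / n = r ^ 2 := by rw [hr2, hn]; field_simp
  set q : ℝ := κ + 1 / k ^ 2 with hq
  have hn2 : n = 100 * k ^ 2 := by rw [hn, hm]; push_cast; ring
  -- The reason for `m = 100 k`: the fourth moments of one step contribute `3 / n` from `A 1` and
  -- `96 / n` from the Gaussian, and `99 / n ≤ 1 / k²` since `n = 100 k²`.
  have hqn : κ + 99 / n ≤ q := by
    rw [hq, hn2]
    refine add_le_add le_rfl ?_
    rw [div_le_div_iff₀ (by positivity) (by positivity)]
    nlinarith [sq_nonneg (k : ℝ)]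
  have hq0 : 0 < q := by positivity
  have hqr : q ≤ 2 * r ^ 2 := by
    have h1 : κ ≤ r ^ 2 := by rw [hr2, le_div_iff₀ hk0]; linarith
    have h2 : 1 / (k : ℝ) ^ 2 ≤ r ^ 2 := by
      rw [hr2]; apply one_div_le_one_div_of_le hk0
      have : (1 : ℝ) ≤ k := by exact_mod_cast (by omega : 1 ≤ k)
      nlinarith
    linarith
  have hq4 : r ^ 4 ≤ q := by
    have : r ^ 4 = 1 / (k : ℝ) ^ 2 := by
      rw [show (4 : ℕ) = 2 * 2 from rfl, pow_mul, hr2, div_pow, one_pow]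
    rw [this, hq]; linarith
  let v : ℝ≥0 := ⟨1 / n, by positivity⟩
  have hvpos : 0 < v := by
    have : (0 : ℝ) < 1 / n := by positivity
    exact this
  let B : ℕ → Measure ℝ := fun j ↦ gaussianReal 0 (j * v)
  have hBv : ∀ j : ℕ, ((j * v : ℝ≥0) : ℝ) = j / n := fun j ↦ by
    push_cast; change (j : ℝ) * (1 / n) = _; ring
  have hB4 : ∀ i, Integrable (fun x : ℝ ↦ x ^ 4) (B i) := fun i ↦
    integrable_pow_four_gaussianReal _
  have hB0 : B 0 = Measure.dirac 0 := by simp [B]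
  have hB : ∀ i, B (i + 1) = B i ∗ B 1 := fun i ↦ by
    simp only [B]
    rw [gaussianReal_conv_gaussianReal]
    congr 1
    · simp
    · push_cast; ring
  have hB1 : ∫ x, x ∂(B 1) = 0 := by simp [B]
  have hB2 : ∫ x, x ^ 2 ∂(B 1) = 1 / n := by
    simp only [B]; rw [integral_sq_gaussianReal, hBv]; simp
  have hB3 : ∫ x, x ^ 3 ∂(B 1) = 0 := integral_pow_three_gaussianReal _
  have hB4' : ∫ x, x ^ 4 ∂(B 1) ≤ 96 / n ^ 2 := by
    have := integral_pow_four_gaussianReal_le (((1 : ℕ) : ℝ≥0) * v) (by simpa using hvpos)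
    rw [hBv] at this
    refine this.trans_eq ?_
    rw [div_pow]; simp; ring
  have h44 : ∫ x, x ^ 4 ∂(A 1) + ∫ x, x ^ 4 ∂(B 1) ≤ q / n := by
    rw [h4]
    have : (κ + 3 / n) / n + 96 / n ^ 2 = (κ + 99 / n) / n := by field_simp; ring
    calc _ ≤ (κ + 3 / n) / n + 96 / n ^ 2 := by gcongr
      _ = (κ + 99 / n) / n := this
      _ ≤ q / n := by gcongr
  -- The `m` steps together thus contribute a factor `m / n = r²`.
  have h3 : |∫ x, x ^ 3 ∂(A 1)| ≤ √q / n := by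
    refine (abs_integral_pow_three_le (hA4 1)).trans ?_
    rw [h2, h4]
    apply Real.sqrt_le_iff.2 ⟨by positivity, ?_⟩
    rw [div_pow, Real.sq_sqrt hq0.le]
    have : 1 / n * ((κ + 3 / n) / n) = (κ + 3 / n) / n ^ 2 := by field_simp
    rw [this]
    gcongr
    have : 3 / n ≤ 99 / n := by gcongr; norm_num
    linarith
  have hAB2 : ∀ i j, ∫ x, x ^ 2 ∂(A i ∗ B j) = (i + j) / n := fun i j ↦ by
    rw [integral_sq_conv (hA4 i) (hB4 j), integral_sq_semigroup hA4 hA0 hA hA1,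
      integral_sq_semigroup hB4 hB0 hB hB1, h2, hB2]
    · ring
    · rw [integral_id_semigroup hB4 hB0 hB, hB1, mul_zero]
  set c' : ℝ := √(2 * Real.log k) * r with hc'
  have hc'0 : 0 ≤ c' := by positivity
  have hcc' : c = c' + r := by rw [hc, hc']; ring
  have hG : ∀ j ≤ m, ∫ x, (max (x - c') 0) ^ 4 ∂(B j) ≤ 24 * r ^ 6 := fun j hj ↦ by
    refine integral_posPart_pow_four_gaussianReal_le hk ?_ hr0 hr2
    rw [hBv, ← hr2, ← hmn]
    gcongr
  -- a crude bound for the mean overshoot gives a first bound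
  have hstage1 : ∀ i j, i + j ≤ m → ∫ x, (max (x - c') 0) ^ 4 ∂(A i ∗ B j)
      ≤ 24 * r ^ 6 + r ^ 2 * (4 * √q * r + q) := fun i j hij ↦ by
    have hK : ∀ i j, i + j < m → ∫ x, max (x - c') 0 ∂(A i ∗ B j) ≤ r := fun i j hij ↦ by
      have h4' := integrable_pow_four_conv (hA4 i) (hB4 j)
      have i1 := (integrable_pow_of_le_four h4' (j := 1) (by norm_num)).abs
      simp only [pow_one] at i1
      calc ∫ x, max (x - c') 0 ∂(A i ∗ B j) ≤ ∫ x, |x| ∂(A i ∗ B j) :=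
            integral_mono (integrable_posPart h4' c') i1 fun x ↦
              max_le (by linarith [le_abs_self x]) (abs_nonneg x)
        _ ≤ √(∫ x, x ^ 2 ∂(A i ∗ B j)) := integral_abs_le_sqrt h4'
        _ ≤ √(r ^ 2) := by
            apply Real.sqrt_le_sqrt
            rw [hAB2, ← hmn]
            have : ((i : ℝ) + j) ≤ m := by exact_mod_cast hij.le
            gcongr
        _ = r := Real.sqrt_sq hr0.le
    refine (integral_posPart_pow_four_conv_le_of_semigroup hA4 hB4 hA0 hA hB hA1 hB1
      (h2.trans hB2.symm) hB3 hK i j hij).trans ?_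
    have him : (i : ℝ) ≤ m := by exact_mod_cast (by omega : i ≤ m)
    have : 4 * |∫ x, x ^ 3 ∂(A 1)| * r + ∫ x, x ^ 4 ∂(A 1) + ∫ x, x ^ 4 ∂(B 1)
        ≤ (4 * √q * r + q) / n := by
      have : 4 * |∫ x, x ^ 3 ∂(A 1)| * r ≤ 4 * (√q / n) * r := by gcongr
      calc _ ≤ 4 * (√q / n) * r + q / n := by linarith
        _ = _ := by ring
    calc _ ≤ 24 * r ^ 6 + (m : ℝ) * ((4 * √q * r + q) / n) := by
          have hx := hG (i + j) hij
          gcongr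
      _ = 24 * r ^ 6 + m / n * (4 * √q * r + q) := by ring
      _ = _ := by rw [hmn]
  -- the first bound improves the bound for the mean overshoot
  set K2 : ℝ := 24 * r ^ 3 + 4 * √q + q / r with hK2
  have hK : ∀ i j, i + j < m → ∫ x, max (x - c) 0 ∂(A i ∗ B j) ≤ K2 := fun i j hij ↦ by
    have h4' := integrable_pow_four_conv (hA4 i) (hB4 j)
    have i4 : Integrable (fun x ↦ (max (x - c') 0) ^ 4) (A i ∗ B j) := by
      have := integrable_posPart_pow_four h4' (-c')
      simpa only [neg_add_eq_sub] using this
    -- Where `x > c = c' + r` one has `x - c' ≥ r`, which trades three powers of `r` for three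
    -- powers of the overshoot over `c'`.
    calc ∫ x, max (x - c) 0 ∂(A i ∗ B j)
        ≤ ∫ x, 1 / r ^ 3 * (max (x - c') 0) ^ 4 ∂(A i ∗ B j) := by
          refine integral_mono (integrable_posPart h4' c) (i4.const_mul _) fun x ↦ ?_
          refine max_le ?_ (by positivity)
          rw [one_div, inv_mul_eq_div, le_div_iff₀ (by positivity)]
          rcases le_total x c with hx | hx
          · have : (x - c) * r ^ 3 ≤ 0 :=
              mul_nonpos_of_nonpos_of_nonneg (by linarith) (by positivity)
            have : 0 ≤ (max (x - c') 0) ^ 4 := by positivity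
            linarith
          · have hxc : r ≤ x - c' := by rw [hcc'] at hx; linarith
            rw [max_eq_left (by linarith)]
            have : (x - c) ≤ x - c' := by linarith
            have h0 : 0 ≤ x - c' := by linarith
            calc (x - c) * r ^ 3 ≤ (x - c') * (x - c') ^ 3 := by gcongr
              _ = _ := by ring
      _ = 1 / r ^ 3 * ∫ x, (max (x - c') 0) ^ 4 ∂(A i ∗ B j) := integral_const_mul _ _
      _ ≤ 1 / r ^ 3 * (24 * r ^ 6 + r ^ 2 * (4 * √q * r + q)) := by
          gcongr; exact hstage1 i j hij.le
      _ = K2 := by rw [hK2]; field_simp; ring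
  have hfin := integral_posPart_pow_four_conv_le_of_semigroup hA4 hB4 hA0 hA hB hA1 hB1
      (h2.trans hB2.symm) hB3 hK m 0 le_rfl
  rw [hB0, Measure.conv_dirac_zero, add_zero] at hfin
  have hGc : ∫ x, (max (x - c) 0) ^ 4 ∂(B m) ≤ 24 * r ^ 6 := by
    refine le_trans (integral_mono ?_ ?_ fun x ↦ ?_) (hG m le_rfl)
    · have := integrable_posPart_pow_four (hB4 m) (-c)
      simpa only [neg_add_eq_sub] using this
    · have := integrable_posPart_pow_four (hB4 m) (-c')
      simpa only [neg_add_eq_sub] using this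
    · have : max (x - c) 0 ≤ max (x - c') 0 := max_le_max (by linarith) le_rfl
      exact pow_le_pow_left₀ (le_max_right _ _) this 4
  have hs0 : 0 ≤ √q := Real.sqrt_nonneg q
  have hK20 : 0 ≤ K2 := by positivity
  have hsum : 4 * |∫ x, x ^ 3 ∂(A 1)| * K2 + ∫ x, x ^ 4 ∂(A 1) + ∫ x, x ^ 4 ∂(B 1)
        ≤ (4 * √q * K2 + q) / n := by
    have : 4 * |∫ x, x ^ 3 ∂(A 1)| * K2 ≤ 4 * (√q / n) * K2 := by gcongr
    calc _ ≤ 4 * (√q / n) * K2 + q / n := by linarith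
      _ = _ := by ring
  have hfin2 : ∫ x, (max (x - c) 0) ^ 4 ∂(A m) ≤ 24 * r ^ 6 + r ^ 2 * (4 * √q * K2 + q) := by
    calc _ ≤ 24 * r ^ 6 + (m : ℝ) * ((4 * √q * K2 + q) / n) := by
          refine hfin.trans ?_
          gcongr
      _ = 24 * r ^ 6 + m / n * (4 * √q * K2 + q) := by ring
      _ = _ := by rw [hmn]
  have hr1 : r ^ 2 ≤ 1 := by
    rw [hr2, div_le_one hk0]; exact_mod_cast (by omega : 1 ≤ k)
  calc _ ≤ 24 * r ^ 6 + r ^ 2 * (4 * √q * K2 + q) := hfin2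
    _ ≤ 143 * q * (r ^ 2) := overshoot_bound_le hr0 hr1 hq0 hqr hq4
    _ = _ := by rw [hr2]; ring

end Iteration

/-! ### Doob's maximal inequality for overshoots of random walks -/

section Doob

/-- The pathwise form of Doob's `L²` maximal inequality. -/
lemma partialSups_sq_le (s : ℕ → ℝ) (n : ℕ) :
    (partialSups s n) ^ 2
      ≤ 4 * s n ^ 2 - 4 * ∑ i ∈ Finset.range n, partialSups s i * (s (i + 1) - s i) := by
  -- Discrete summation by parts: the running maximum changes only at times when it equals `s`, so
  -- it integrates against itself to at least half its square.
  have key : ∑ i ∈ Finset.range n, partialSups s i * (s (i + 1) - s i)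
      + (partialSups s n) ^ 2 / 2 ≤ partialSups s n * s n := by
    induction n with
    | zero => simp; nlinarith [sq_nonneg (s 0)]
    | succ n ih =>
      rw [Finset.sum_range_succ, partialSups_add_one]
      rcases le_total (s (n + 1)) (partialSups s n) with h | h
      · rw [sup_eq_left.2 h]; nlinarith
      · rw [sup_eq_right.2 h]; nlinarith [sq_nonneg (s (n + 1) - partialSups s n)]
  nlinarith [sq_nonneg (partialSups s n - 2 * s n)]

/-- The overshoot `(|y| - c)₊`. -/
noncomputable def overshoot (c y : ℝ) : ℝ := max (|y| - c) 0

/-- A subgradient of the overshoot. -/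
noncomputable def overshootSlope (c y : ℝ) : ℝ := if c < y then 1 else if y < -c then -1 else 0

lemma overshoot_nonneg (c y : ℝ) : 0 ≤ overshoot c y := le_max_right _ _

lemma measurable_overshoot (c : ℝ) : Measurable (overshoot c) := by
  unfold overshoot; fun_prop

lemma measurable_overshootSlope (c : ℝ) : Measurable (overshootSlope c) :=
  Measurable.ite measurableSet_Ioi measurable_const
    (Measurable.ite measurableSet_Iio measurable_const measurable_const)

lemma abs_overshootSlope_le (c y : ℝ) : |overshootSlope c y| ≤ 1 := by
  unfold overshootSlope; split_ifs <;> simp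

lemma overshoot_le_abs {c : ℝ} (hc : 0 ≤ c) (y : ℝ) : overshoot c y ≤ |y| :=
  max_le (by linarith) (abs_nonneg y)

/-- Convexity of the overshoot. Its increments along a walk dominate slope times step, and the slope
depends only on the past, so these products have mean zero. -/
lemma overshootSlope_mul_le {c : ℝ} (hc : 0 ≤ c) (y z : ℝ) :
    overshootSlope c y * z ≤ overshoot c (y + z) - overshoot c y := by
  unfold overshootSlope overshoot
  have h1 := le_abs_self (y + z)
  have h2 := neg_abs_le (y + z)
  split_ifs with h h'
  · rw [abs_of_pos (hc.trans_lt h), max_eq_left (by linarith : (0 : ℝ) ≤ y - c)]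
    linarith [le_max_left (|y + z| - c) 0]
  · rw [abs_of_neg (by linarith : y < 0), max_eq_left (by linarith : (0 : ℝ) ≤ -y - c)]
    linarith [le_max_left (|y + z| - c) 0]
  · have : |y| ≤ c := abs_le.2 ⟨by linarith, by linarith⟩
    rw [max_eq_right (by linarith : |y| - c ≤ 0)]
    simp

variable {Ω : Type*} [MeasurableSpace Ω] {P : Measure Ω}

lemma measurable_partialSups {β : Type*} [MeasurableSpace β] {f : ℕ → β → ℝ}
    (hf : ∀ i, Measurable (f i)) (n : ℕ) :
    Measurable fun b ↦ partialSups (fun i ↦ f i b) n := by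
  induction n with
  | zero => simpa using hf 0
  | succ n ih =>
    simp_rw [partialSups_add_one]
    exact ih.sup (hf _)

lemma integrable_partialSups {f : ℕ → Ω → ℝ} (hf : ∀ i, Integrable (f i) P) (n : ℕ) :
    Integrable (fun ω ↦ partialSups (fun i ↦ f i ω) n) P := by
  induction n with
  | zero => simpa using hf 0
  | succ n ih =>
    simp_rw [partialSups_add_one]
    exact ih.sup (hf _)

/-- A step of a random walk is independent of a functional of the previous path. -/
lemma indepFun_partialSups_mul {ξ : ℕ → Ω → ℝ} (hind : iIndepFun ξ P)
    (hmeas : ∀ i, AEMeasurable (ξ i) P) {f g : ℝ → ℝ} (hf : Measurable f) (hg : Measurable g)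
    (n : ℕ) :
    IndepFun (fun ω ↦ partialSups (fun i ↦ f (∑ j ∈ Finset.range i, ξ j ω)) n
      * g (∑ j ∈ Finset.range n, ξ j ω)) (ξ n) P := by
  have h := hind.indepFun_finset₀ (Finset.range n) {n} (by simp) hmeas
  -- Extending the first `n` steps by zero exhibits the functional as a measurable function of a
  -- finite tuple, as the independence of disjoint blocks requires.
  let ext : (Finset.range n → ℝ) → ℕ → ℝ := fun y j ↦ if h : j ∈ Finset.range n then y ⟨j, h⟩ else 0
  have hext : ∀ j, Measurable fun y ↦ ext y j := fun j ↦ by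
    by_cases h : j ∈ Finset.range n
    · simp only [ext, h, dite_true]; exact measurable_pi_apply _
    · simp only [ext, h, dite_false]; exact measurable_const
  have hS : ∀ i, Measurable fun y ↦ ∑ j ∈ Finset.range i, ext y j := fun i ↦
    Finset.measurable_sum _ fun j _ ↦ hext j
  let Φ : (Finset.range n → ℝ) → ℝ := fun y ↦
    partialSups (fun i ↦ f (∑ j ∈ Finset.range i, ext y j)) n * g (∑ j ∈ Finset.range n, ext y j)
  have hΦ : Measurable Φ :=
    (measurable_partialSups (fun i ↦ hf.comp (hS i)) n).mul (hg.comp (hS n))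
  let Ψ : (({n} : Finset ℕ) → ℝ) → ℝ := fun y ↦ y ⟨n, by simp⟩
  have hΨ : Measurable Ψ := measurable_pi_apply _
  have h' := h.comp hΦ hΨ
  refine h'.congr (ae_of_all _ fun ω ↦ ?_) (ae_of_all _ fun ω ↦ rfl)
  have e : ∀ i ≤ n, ∑ j ∈ Finset.range i, ext (fun l : Finset.range n ↦ ξ l ω) j
      = ∑ j ∈ Finset.range i, ξ j ω := fun i hi ↦ by
    refine Finset.sum_congr rfl fun j hj ↦ ?_
    have : j ∈ Finset.range n := Finset.mem_range.2 ((Finset.mem_range.1 hj).trans_le hi)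
    simp only [ext, this, dite_true]
  simp only [Φ, Function.comp]
  rw [e n le_rfl]
  congr 1
  rw [partialSups_eq_sup'_range, partialSups_eq_sup'_range]
  refine Finset.sup'_congr _ rfl fun i hi ↦ ?_
  rw [e i (by simpa [Nat.lt_succ_iff] using hi)]

/-- Doob's maximal inequality for the overshoot of a centred random walk. -/
lemma lintegral_partialSups_overshoot_le [IsProbabilityMeasure P] {ξ : ℕ → Ω → ℝ} (hind : iIndepFun ξ P)
    (hL2 : ∀ i, MemLp (ξ i) 2 P) (hmean : ∀ i, ∫ ω, ξ i ω ∂P = 0) {c : ℝ} (hc : 0 ≤ c) (n : ℕ) :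
    ∫⁻ ω, ENNReal.ofReal
        ((partialSups (fun i ↦ overshoot c (∑ j ∈ Finset.range i, ξ j ω)) n) ^ 2) ∂P
      ≤ ENNReal.ofReal (4 * ∫ ω, (overshoot c (∑ j ∈ Finset.range n, ξ j ω)) ^ 2 ∂P) := by
  have hmeas : ∀ i, AEMeasurable (ξ i) P := fun i ↦ (hL2 i).aestronglyMeasurable.aemeasurable
  have hint : ∀ i, Integrable (ξ i) P := fun i ↦ (hL2 i).integrable (by norm_num)
  set s : ℕ → Ω → ℝ := fun i ω ↦ overshoot c (∑ j ∈ Finset.range i, ξ j ω) with hs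
  have hSL2 : ∀ i, MemLp (fun ω ↦ ∑ j ∈ Finset.range i, ξ j ω) 2 P := fun i ↦
    memLp_finsetSum _ fun j _ ↦ hL2 j
  have hsL2 : ∀ i, MemLp (s i) 2 P := fun i ↦ by
    refine (hSL2 i).mono ((measurable_overshoot c).comp_aemeasurable
      (hSL2 i).aestronglyMeasurable.aemeasurable).aestronglyMeasurable (ae_of_all _ fun ω ↦ ?_)
    simp only [hs, Real.norm_eq_abs]
    rw [abs_of_nonneg (overshoot_nonneg _ _)]
    exact overshoot_le_abs hc _
  have hsint : ∀ i, Integrable (s i) P := fun i ↦ (hsL2 i).integrable (by norm_num)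
  let W : ℕ → Ω → ℝ := fun i ω ↦ partialSups (fun l ↦ s l ω) i
      * overshootSlope c (∑ j ∈ Finset.range i, ξ j ω)
  have hWint : ∀ i, Integrable (W i) P := fun i ↦ by
    refine (integrable_partialSups hsint i).mul_bdd (c := 1) ?_ (ae_of_all _ fun ω ↦ ?_)
    · exact ((measurable_overshootSlope c).comp_aemeasurable
        (hSL2 i).aestronglyMeasurable.aemeasurable).aestronglyMeasurable
    · exact abs_overshootSlope_le _ _
  have hWind : ∀ i, IndepFun (W i) (ξ i) P := fun i ↦
    indepFun_partialSups_mul hind hmeas (measurable_overshoot c) (measurable_overshootSlope c) i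
  have hWξ : ∀ i, Integrable (fun ω ↦ W i ω * ξ i ω) P := fun i ↦
    (hWind i).integrable_mul (hWint i) (hint i)
  have hWξ0 : ∀ i, ∫ ω, W i ω * ξ i ω ∂P = 0 := fun i ↦ by
    have := (hWind i).integral_fun_mul_eq_mul_integral (hWint i).aestronglyMeasurable
      (hint i).aestronglyMeasurable
    rw [this, hmean, mul_zero]
  -- An integrable majorant of the squared maximum; its sum has mean zero, leaving only `4 s n ^ 2`.
  let Z : Ω → ℝ := fun ω ↦ 4 * s n ω ^ 2 - 4 * ∑ i ∈ Finset.range n, W i ω * ξ i ω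
  have hle : ∀ ω, (partialSups (fun i ↦ s i ω) n) ^ 2 ≤ Z ω := fun ω ↦ by
    refine (partialSups_sq_le (fun i ↦ s i ω) n).trans ?_
    refine sub_le_sub_left (mul_le_mul_of_nonneg_left (Finset.sum_le_sum fun i _ ↦ ?_)
      (by norm_num)) _
    have h1 := overshootSlope_mul_le hc (∑ j ∈ Finset.range i, ξ j ω) (ξ i ω)
    rw [← Finset.sum_range_succ] at h1
    have h0 : 0 ≤ partialSups (fun i ↦ s i ω) i :=
      (overshoot_nonneg c _).trans (le_partialSups (fun i ↦ s i ω) i)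
    change _ * _ * _ ≤ _
    rw [mul_assoc]
    exact mul_le_mul_of_nonneg_left h1 h0
  have hsq : Integrable (fun ω ↦ 4 * s n ω ^ 2) P := (hsL2 n).integrable_sq.const_mul 4
  have hsum : Integrable (fun ω ↦ 4 * ∑ i ∈ Finset.range n, W i ω * ξ i ω) P :=
    (integrable_finsetSum _ fun i _ ↦ hWξ i).const_mul 4
  have hZ : Integrable Z P := hsq.sub hsum
  calc _ ≤ ∫⁻ ω, ENNReal.ofReal (Z ω) ∂P :=
        lintegral_mono fun ω ↦ ENNReal.ofReal_le_ofReal (hle ω)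
    _ = ENNReal.ofReal (∫ ω, Z ω ∂P) :=
        (ofReal_integral_eq_lintegral_ofReal hZ
          (ae_of_all _ fun ω ↦ (sq_nonneg _).trans (hle ω))).symm
    _ = _ := by
        congr 1
        simp only [Z]
        rw [integral_sub hsq hsum, integral_const_mul, integral_const_mul,
          integral_finsetSum _ fun i _ ↦ hWξ i]
        simp [hWξ0, hs]

end Doob

/-! ### Existence of the Lévy–Khintchine representation -/

section Existence

lemma norm_exp_I_mul_sub_one_sub_le (y : ℝ) :
    ‖Complex.exp (Complex.I * y) - 1 - Complex.I * y‖ ≤ 2 * y ^ 2 := by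
  have hn : ‖Complex.I * (y : ℂ)‖ = |y| := by simp
  rcases le_total |y| 1 with h | h
  · have := Complex.norm_exp_sub_one_sub_id_le (x := Complex.I * y) (by rw [hn]; exact h)
    rw [hn, sq_abs] at this
    nlinarith [sq_nonneg y]
  · have h1 : ‖Complex.exp (Complex.I * y) - 1‖ ≤ |y| := Real.norm_exp_I_mul_ofReal_sub_one_le
    calc _ ≤ ‖Complex.exp (Complex.I * y) - 1‖ + ‖Complex.I * (y : ℂ)‖ := norm_sub_le _ _
      _ ≤ |y| + |y| := by rw [hn]; gcongr
      _ ≤ 2 * y ^ 2 := by rw [← sq_abs]; nlinarith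

/-- The kernel `x ↦ (exp (i u x) - 1 - i u x) / x²` of the Kolmogorov representation. -/
noncomputable def kolmogorovKernel (u x : ℝ) : ℂ :=
  if x = 0 then -(u : ℂ) ^ 2 / 2
  else (Complex.exp (Complex.I * (u * x : ℝ)) - 1 - Complex.I * (u * x : ℝ)) / (x : ℂ) ^ 2

lemma norm_kolmogorovKernel_le (u x : ℝ) : ‖kolmogorovKernel u x‖ ≤ 2 * u ^ 2 := by
  unfold kolmogorovKernel
  split_ifs with h
  · simp; nlinarith [sq_nonneg u]
  · have hx : (x : ℂ) ≠ 0 := by exact_mod_cast h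
    rw [norm_div, div_le_iff₀ (norm_pos_iff.2 (pow_ne_zero _ hx))]
    refine (norm_exp_I_mul_sub_one_sub_le _).trans_eq ?_
    simp; ring

lemma sq_mul_kolmogorovKernel (u x : ℝ) :
    (x : ℂ) ^ 2 * kolmogorovKernel u x
      = Complex.exp (Complex.I * (u * x : ℝ)) - 1 - Complex.I * (u * x : ℝ) := by
  unfold kolmogorovKernel
  split_ifs with h
  · simp [h]
  · have : (x : ℂ) ≠ 0 := by exact_mod_cast h
    field_simp

/-- The value at `0` is the second-order Taylor coefficient, so the difference is the third-order
remainder of the exponential divided by `x²`. This gives continuity at `0`, needed for weak limits.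
-/
lemma norm_kolmogorovKernel_sub_le (u x : ℝ) :
    ‖kolmogorovKernel u x - kolmogorovKernel u 0‖ ≤ |u| ^ 3 * |x| * Real.exp |u * x| := by
  by_cases h : x = 0
  · subst h; simp
  have hx : (x : ℂ) ≠ 0 := by exact_mod_cast h
  have e : kolmogorovKernel u x - kolmogorovKernel u 0
      = (Complex.exp (Complex.I * (u * x : ℝ))
        - ∑ m ∈ Finset.range 3, (Complex.I * (u * x : ℝ)) ^ m / (m.factorial : ℂ)) / (x : ℂ) ^ 2 := by
    simp only [kolmogorovKernel, h, if_false, if_true, Finset.sum_range_succ, Finset.sum_range_zero]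
    push_cast
    field_simp
    simp [Nat.factorial, Complex.I_sq]
    ring
  have hn : ‖Complex.I * ((u * x : ℝ) : ℂ)‖ = |u * x| := by
    rw [norm_mul, Complex.norm_I, one_mul, Complex.norm_real, Real.norm_eq_abs]
  have hx2 : 0 < ‖(x : ℂ) ^ 2‖ := norm_pos_iff.2 (pow_ne_zero _ hx)
  rw [e, norm_div, div_le_iff₀ hx2]
  refine (Complex.norm_exp_sub_sum_le_norm_mul_exp _ _).trans_eq ?_
  rw [hn, norm_pow, Complex.norm_real, Real.norm_eq_abs, abs_mul]
  ring

lemma continuous_kolmogorovKernel (u : ℝ) : Continuous (kolmogorovKernel u) := by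
  rw [continuous_iff_continuousAt]
  intro x
  by_cases h : x = 0
  · subst h
    rw [ContinuousAt, tendsto_iff_norm_sub_tendsto_zero]
    refine squeeze_zero (fun _ ↦ norm_nonneg _) (norm_kolmogorovKernel_sub_le u) ?_
    have : Continuous fun x : ℝ ↦ |u| ^ 3 * |x| * Real.exp |u * x| := by fun_prop
    simpa using this.tendsto 0
  · have : kolmogorovKernel u =ᶠ[𝓝 x] fun x ↦
        (Complex.exp (Complex.I * (u * x : ℝ)) - 1 - Complex.I * (u * x : ℝ)) / (x : ℂ) ^ 2 := by
      filter_upwards [isOpen_ne.mem_nhds h] with y hy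
      simp [kolmogorovKernel, hy]
    refine ContinuousAt.congr ?_ this.symm
    have hx : (x : ℂ) ^ 2 ≠ 0 := pow_ne_zero _ (by exact_mod_cast h)
    exact ContinuousAt.div (by fun_prop) (by fun_prop) hx

lemma integrable_kolmogorovKernel (G : Measure ℝ) [IsFiniteMeasure G] (u : ℝ) :
    Integrable (kolmogorovKernel u) G :=
  (integrable_const (2 * u ^ 2)).mono' (continuous_kolmogorovKernel u).aestronglyMeasurable
    (ae_of_all _ (norm_kolmogorovKernel_le u))

/-- A law with a Kolmogorov representation has a Lévy–Khintchine representation. -/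
lemma exists_hasLevyTriplet_of_kolmogorov {μ : Measure ℝ} (G : Measure ℝ) [IsFiniteMeasure G]
    (h : ∀ u, charFun μ u = Complex.exp (∫ x, kolmogorovKernel u x ∂G)) :
    ∃ ν : Measure ℝ, ∃ (b : ℝ) (v : ℝ≥0), HasLevyTriplet μ b v ν := by
  have hdm : Measurable fun x : ℝ ↦ ENNReal.ofReal ((x ^ 2)⁻¹) := by fun_prop
  let B : ℝ → ℝ := (Set.Icc (-1 : ℝ) 1)ᶜ.indicator fun x ↦ x⁻¹
  have hBm : Measurable B := (measurable_inv).indicator measurableSet_Icc.compl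
  have hBi : Integrable B G := by
    refine (integrable_const (1 : ℝ)).mono' hBm.aestronglyMeasurable (ae_of_all _ fun x ↦ ?_)
    simp only [B, Set.indicator_apply]
    split_ifs with hx
    · rw [norm_inv]
      apply inv_le_one_of_one_le₀
      by_contra hlt
      exact hx (abs_le.1 (le_of_lt (not_le.1 hlt)))
    · simp
  -- The density `1 / x²` has value `0` at `0` by the convention for inverses, which removes the
  -- atom of `G` there; since the kernel at `0` is `-u² / 2`, that atom becomes the Gaussian
  -- variance. The drift corrects the linear term, which the kernel does not truncate to `|x| ≤ 1`.
  refine ⟨G.withDensity fun x ↦ ENNReal.ofReal ((x ^ 2)⁻¹), -∫ x, B x ∂G, (G {0}).toNNReal,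
    ?_, ?_, fun u ↦ ?_⟩
  · rw [withDensity_apply _ (measurableSet_singleton _), lintegral_singleton]
    simp
  · rw [lintegral_withDensity_eq_lintegral_mul _ hdm (by fun_prop)]
    refine lt_of_le_of_lt (lintegral_mono (g := fun _ ↦ 1) fun x ↦ ?_) (by simp)
    simp only [Pi.mul_apply]
    rw [← ENNReal.ofReal_mul (by positivity), ← ENNReal.ofReal_one]
    apply ENNReal.ofReal_le_ofReal
    calc (x ^ 2)⁻¹ * min 1 (x ^ 2) ≤ (x ^ 2)⁻¹ * x ^ 2 := by gcongr; exact min_le_right _ _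
      _ ≤ 1 := inv_mul_le_one
  · rw [h u, integral_withDensity_eq_integral_toReal_smul hdm (by simp)]
    have e : ∀ x : ℝ, (ENNReal.ofReal ((x ^ 2)⁻¹)).toReal • (Complex.exp (Complex.I * u * x) - 1
          - Set.indicator (Set.Icc (-1 : ℝ) 1) (fun y : ℝ ↦ Complex.I * u * y) x)
        = kolmogorovKernel u x + Set.indicator {0} (fun _ ↦ (u : ℂ) ^ 2 / 2) x
          + Complex.I * u * (B x : ℂ) := fun x ↦ by
      rw [ENNReal.toReal_ofReal (by positivity), Complex.real_smul]
      by_cases hx : x = 0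
      · subst hx
        simp [kolmogorovKernel, B]
        ring
      · have hx' : (x : ℂ) ≠ 0 := by exact_mod_cast hx
        have h0 : Set.indicator {0} (fun _ ↦ (u : ℂ) ^ 2 / 2) x = 0 :=
          Set.indicator_of_notMem (by simpa using hx) _
        rw [h0]
        by_cases hI : x ∈ Set.Icc (-1 : ℝ) 1
        · have hB0 : B x = 0 := Set.indicator_of_notMem (by simpa using hI) _
          rw [Set.indicator_of_mem hI, hB0]
          simp only [kolmogorovKernel, hx, if_false]
          push_cast
          field_simp
          simp [mul_assoc]
        · have hB1 : B x = x⁻¹ := Set.indicator_of_mem hI _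
          rw [Set.indicator_of_notMem hI, hB1]
          simp only [kolmogorovKernel, hx, if_false]
          push_cast
          field_simp
          ring_nf
    rw [integral_congr_ae (ae_of_all _ e)]
    have i1 := integrable_kolmogorovKernel G u
    have i2 : Integrable (Set.indicator {0} (fun _ ↦ (u : ℂ) ^ 2 / 2)) G :=
      (integrable_const _).indicator (measurableSet_singleton _)
    have i12 : Integrable (fun x ↦ kolmogorovKernel u x
      + Set.indicator {0} (fun _ ↦ (u : ℂ) ^ 2 / 2) x) G := i1.add i2
    have i3 : Integrable (fun x ↦ Complex.I * u * (B x : ℂ)) G := hBi.ofReal.const_mul _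
    rw [integral_add i12 i3, integral_add i1 i2,
      integral_indicator (measurableSet_singleton _), integral_const_mul, integral_complex_ofReal]
    congr 1
    simp [Measure.real, ENNReal.toReal]
    ring

/-- Fill the indices missed by `ψ` with `t / N`, for which `N * (t / N)` is already the limit, and
apply the statement for full sequences. -/
lemma tendsto_one_add_pow_exp_of_strictMono {a : ℕ → ℂ} {t : ℂ} {ψ : ℕ → ℕ} (hψ : StrictMono ψ)
    (h : Tendsto (fun j ↦ (ψ j : ℂ) * a j) atTop (𝓝 t)) :
    Tendsto (fun j ↦ (1 + a j) ^ ψ j) atTop (𝓝 (Complex.exp t)) := by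
  let g : ℕ → ℂ := Function.extend ψ a fun N ↦ t / N
  have hg : Tendsto (fun N : ℕ ↦ (N : ℂ) * g N) atTop (𝓝 t) := by
    rw [Metric.tendsto_atTop] at h ⊢
    intro ε hε
    obtain ⟨J, hJ⟩ := h ε hε
    refine ⟨max (ψ J) 1, fun N hN ↦ ?_⟩
    by_cases hr : ∃ j, ψ j = N
    · obtain ⟨j, rfl⟩ := hr
      simp only [g, hψ.injective.extend_apply]
      exact hJ j (hψ.le_iff_le.1 ((le_max_left _ _).trans hN))
    · simp only [g, Function.extend_apply' _ _ _ hr]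
      have : (N : ℂ) ≠ 0 := by
        have : 1 ≤ N := (le_max_right _ _).trans hN
        exact_mod_cast (by omega : N ≠ 0)
      rw [mul_div_cancel₀ _ this, dist_self]
      exact hε
  have := (Complex.tendsto_one_add_pow_exp_of_tendsto hg).comp hψ.tendsto_atTop
  refine this.congr fun j ↦ ?_
  simp only [Function.comp, g, hψ.injective.extend_apply]

/-- An infinitely divisible law whose roots are centred, with variance `1 / n` and fourth moment
of order `1 / n`, has a Lévy–Khintchine representation. -/
lemma exists_hasLevyTriplet {μ : Measure ℝ} (α : ℕ → Measure ℝ) [∀ n, IsProbabilityMeasure (α n)]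
    (hroot : ∀ n u, charFun (α n) u ^ (n + 1) = charFun μ u)
    (h4 : ∀ n, Integrable (fun x : ℝ ↦ x ^ 4) (α n)) (h1 : ∀ n, ∫ x, x ∂(α n) = 0)
    (h2 : ∀ n : ℕ, ∫ x, x ^ 2 ∂(α n) = 1 / (n + 1)) {K : ℝ}
    (hK : ∀ n : ℕ, (n + 1) * ∫ x, x ^ 4 ∂(α n) ≤ K) :
    ∃ ν : Measure ℝ, ∃ (b : ℝ) (v : ℝ≥0), HasLevyTriplet μ b v ν := by
  -- The index is shifted: `α n` is the root of order `n + 1`. The variance hypothesis makes each `G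
  -- n` a probability measure, and `K` bounds its second moment, hence tightness by Chebyshev's
  -- inequality.
  let G : ℕ → Measure ℝ := fun n ↦
    (α n).withDensity fun x ↦ ENNReal.ofReal ((n + 1) * x ^ 2)
  have hdm : ∀ n : ℕ, Measurable fun x : ℝ ↦ ENNReal.ofReal ((n + 1) * x ^ 2) := fun n ↦ by fun_prop
  have hi2 : ∀ n, Integrable (fun x : ℝ ↦ x ^ 2) (α n) := fun n ↦
    integrable_pow_of_le_four (h4 n) (by norm_num)
  have hi1 : ∀ n, Integrable (fun x : ℝ ↦ x) (α n) := fun n ↦ by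
    simpa using integrable_pow_of_le_four (h4 n) (j := 1) (by norm_num)
  have hG : ∀ n, IsProbabilityMeasure (G n) := fun n ↦ ⟨by
    simp only [G]
    rw [withDensity_apply _ MeasurableSet.univ, Measure.restrict_univ,
      ← ofReal_integral_eq_lintegral_ofReal ((hi2 n).const_mul _)
        (ae_of_all _ fun x ↦ by positivity), integral_const_mul, h2]
    have : (n + 1 : ℝ) ≠ 0 := by positivity
    rw [mul_one_div_cancel this, ENNReal.ofReal_one]⟩
  have hmom : ∀ n, ∫⁻ x, ENNReal.ofReal (x ^ 2) ∂(G n) ≤ ENNReal.ofReal K := fun n ↦ by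
    simp only [G]
    rw [lintegral_withDensity_eq_lintegral_mul _ (hdm n) (by fun_prop)]
    have e : ∀ x : ℝ, ((fun x : ℝ ↦ ENNReal.ofReal ((n + 1) * x ^ 2))
        * fun x ↦ ENNReal.ofReal (x ^ 2)) x = ENNReal.ofReal ((n + 1) * x ^ 4) := fun x ↦ by
      simp only [Pi.mul_apply]
      rw [← ENNReal.ofReal_mul (by positivity)]
      ring_nf
    simp_rw [e]
    rw [← ofReal_integral_eq_lintegral_ofReal ((h4 n).const_mul _)
        (ae_of_all _ fun x ↦ by positivity), integral_const_mul]
    exact ENNReal.ofReal_le_ofReal (hK n)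
  let GP : ℕ → ProbabilityMeasure ℝ := fun n ↦ ⟨G n, hG n⟩
  have htight : IsTightMeasureSet {m : Measure ℝ | ∃ ν ∈ Set.range GP, (ν : Measure ℝ) = m} := by
    apply isTightMeasureSet_of_tendsto_measure_norm_gt
    have hlim : Tendsto (fun r : ℝ ↦ ENNReal.ofReal K / ENNReal.ofReal (r ^ 2)) atTop (𝓝 0) := by
      have : Tendsto (fun r : ℝ ↦ ENNReal.ofReal (r ^ 2)) atTop (𝓝 ∞) :=
        ENNReal.tendsto_ofReal_atTop.comp (tendsto_pow_atTop (by norm_num))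
      have h := ENNReal.Tendsto.const_div (a := ENNReal.ofReal K) this (Or.inr ENNReal.ofReal_ne_top)
      simpa using h
    refine tendsto_of_tendsto_of_tendsto_of_le_of_le' tendsto_const_nhds hlim
      (Eventually.of_forall fun _ ↦ zero_le) ?_
    filter_upwards [eventually_gt_atTop 0] with r hr
    refine iSup₂_le fun m hm ↦ ?_
    obtain ⟨_, ⟨n, rfl⟩, rfl⟩ := hm
    change G n _ ≤ _
    rw [ENNReal.le_div_iff_mul_le (Or.inl (by simpa using hr.ne'))
      (Or.inl ENNReal.ofReal_ne_top), mul_comm]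
    refine le_trans ?_ ((mul_meas_ge_le_lintegral (μ := G n)
      (f := fun x : ℝ ↦ ENNReal.ofReal (x ^ 2)) (by fun_prop)
      (ENNReal.ofReal (r ^ 2))).trans (hmom n))
    refine mul_le_mul_right (measure_mono fun x hx ↦ ?_) _
    apply ENNReal.ofReal_le_ofReal
    rw [← sq_abs x]
    have : r < |x| := hx
    gcongr
  obtain ⟨G₀, -, ψ, hψ, hlim⟩ := (isCompact_closure_of_isTightMeasureSet htight).tendsto_subseq
    (x := GP) fun n ↦ subset_closure (Set.mem_range_self n)
  refine exists_hasLevyTriplet_of_kolmogorov (G₀ : Measure ℝ) fun u ↦ ?_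
  rw [ProbabilityMeasure.tendsto_iff_forall_integral_rclike_tendsto ℂ] at hlim
  let gb : BoundedContinuousFunction ℝ ℂ := BoundedContinuousFunction.ofNormedAddCommGroup
    (kolmogorovKernel u) (continuous_kolmogorovKernel u) _ (norm_kolmogorovKernel_le u)
  have hl := hlim gb
  -- The factor `x²` of the density cancels the denominator of the kernel, and centring kills the
  -- linear term.
  have hval : ∀ n : ℕ, ∫ x, kolmogorovKernel u x ∂(G n)
      = ((n + 1 : ℕ) : ℂ) * (charFun (α n) u - 1) := fun n ↦ by
    simp only [G]
    rw [integral_withDensity_eq_integral_toReal_smul (hdm n) (by simp)]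
    have e : ∀ x : ℝ, (ENNReal.ofReal ((n + 1) * x ^ 2)).toReal • kolmogorovKernel u x
        = ((n + 1 : ℕ) : ℂ) * (Complex.exp (u * x * Complex.I) - 1 - Complex.I * u * (x : ℂ)) :=
        fun x ↦ by
      rw [ENNReal.toReal_ofReal (by positivity), Complex.real_smul]
      have := sq_mul_kolmogorovKernel u x
      push_cast at this ⊢
      rw [mul_assoc, this]
      ring_nf
    rw [integral_congr_ae (ae_of_all _ e), integral_const_mul]
    congr 1
    have ie : Integrable (fun x : ℝ ↦ Complex.exp (u * x * Complex.I)) (α n) := by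
      refine (integrable_const (1 : ℝ)).mono' (by fun_prop) (ae_of_all _ fun x ↦ ?_)
      have := Complex.norm_exp_ofReal_mul_I (u * x)
      push_cast at this
      rw [this]
    have i1 : Integrable (fun x : ℝ ↦ Complex.exp (u * x * Complex.I) - 1) (α n) :=
      ie.sub (integrable_const _)
    have i2 : Integrable (fun x : ℝ ↦ Complex.I * u * (x : ℂ)) (α n) :=
      (hi1 n).ofReal.const_mul _
    rw [integral_sub i1 i2, integral_sub ie (integrable_const _), integral_const_mul,
      integral_complex_ofReal, h1, charFun_apply_real]
    simp
  have hl' : Tendsto (fun j ↦ ((ψ j + 1 : ℕ) : ℂ) * (charFun (α (ψ j)) u - 1)) atTop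
      (𝓝 (∫ x, kolmogorovKernel u x ∂(G₀ : Measure ℝ))) := by
    refine hl.congr fun j ↦ ?_
    rw [← hval]
    rfl
  have hψ' : StrictMono fun j ↦ ψ j + 1 := fun a b hab ↦ by
    have := hψ hab
    simpa using this
  -- The powers `(1 + (charFun - 1)) ^ (ψ j + 1)` are constantly `charFun μ u`, which therefore
  -- equals the limit.
  have := tendsto_one_add_pow_exp_of_strictMono hψ' hl'
  simp only [add_sub_cancel, hroot] at this
  exact tendsto_nhds_unique tendsto_const_nhds this

end Existence

/-! ### The fourth cumulant and the Lévy measure -/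

section Cumulant

/-- With `z = y / 2`, use `cos y = 1 - 2 sin² z` and `sin z ≥ z - z³ / 6`. Squaring needs `z² ≤ 6`;
beyond that the right side is at least `1`. -/
lemma cos_le_one_sub_add_pow_four (y : ℝ) : Real.cos y ≤ 1 - y ^ 2 / 2 + y ^ 4 / 24 := by
  wlog hy : 0 ≤ y with H
  · have := H (-y) (by linarith)
    rw [Real.cos_neg] at this
    calc _ ≤ _ := this
      _ = _ := by ring
  have hz : 0 ≤ y / 2 := by linarith
  have h1 := Real.sin_ge_sub_cube hz
  have h2 : Real.cos y = 1 - 2 * Real.sin (y / 2) ^ 2 := by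
    have := Real.cos_two_mul' (y / 2)
    rw [mul_div_cancel₀ _ two_ne_zero] at this
    rw [this, Real.cos_sq']; ring
  rw [h2]
  generalize hzz : y / 2 = z at *
  have hy2 : y = 2 * z := by linarith
  subst hy2
  rcases le_total (z ^ 2) 6 with h | h
  · have h3 : 0 ≤ z - z ^ 3 / 6 := by nlinarith
    have h4 : (z - z ^ 3 / 6) ^ 2 ≤ Real.sin z ^ 2 := pow_le_pow_left₀ h3 h1 2
    nlinarith [sq_nonneg (z ^ 3)]
  · nlinarith [sq_nonneg (Real.sin z), sq_nonneg z]

lemma abs_cos_sub_le (y : ℝ) :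
    |Real.cos y - (1 - y ^ 2 / 2 + y ^ 4 / 24)| ≤ |y| ^ 5 * Real.exp |y| := by
  have h := Complex.norm_exp_sub_sum_le_norm_mul_exp (y * Complex.I) 5
  have hn : ‖(y : ℂ) * Complex.I‖ = |y| := by simp
  rw [hn] at h
  refine le_trans ?_ ((Complex.abs_re_le_norm _).trans h)
  have e : (Complex.exp (y * Complex.I)
      - ∑ m ∈ Finset.range 5, (y * Complex.I) ^ m / (m.factorial : ℂ)).re
      = Real.cos y - (1 - y ^ 2 / 2 + y ^ 4 / 24) := by
    have e2 : ∑ m ∈ Finset.range 5, ((y : ℂ) * Complex.I) ^ m / (m.factorial : ℂ)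
        = ((1 - y ^ 2 / 2 + y ^ 4 / 24 : ℝ) : ℂ) + ((y - y ^ 3 / 6 : ℝ) : ℂ) * Complex.I := by
      have i3 : Complex.I ^ 3 = -Complex.I := Complex.I_pow_three
      have i4 : Complex.I ^ 4 = 1 := Complex.I_pow_four
      simp only [Finset.sum_range_succ, Finset.sum_range_zero, mul_pow, Complex.I_sq, i3, i4,
        Nat.factorial]
      push_cast
      ring
    rw [e2, Complex.sub_re, Complex.exp_ofReal_mul_I_re, Complex.add_re, Complex.re_ofReal_mul,
      Complex.I_re, Complex.ofReal_re]
    ring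
  rw [e]

/-- The rescaled fourth order remainder of the cosine converges to the fourth moment. -/
lemma tendsto_integral_cos_remainder {D : Measure ℝ} (h4 : Integrable (fun x : ℝ ↦ x ^ 4) D) :
    Tendsto (fun u : ℝ ↦ ∫ x, (Real.cos (u * x) - 1 + (u * x) ^ 2 / 2) / u ^ 4 ∂D) (𝓝[≠] 0)
      (𝓝 (∫ x, x ^ 4 / 24 ∂D)) := by
  refine tendsto_integral_filter_of_dominated_convergence (fun x ↦ x ^ 4 / 24) ?_ ?_
    (h4.div_const 24) ?_
  · exact Eventually.of_forall fun u ↦ by fun_prop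
  · filter_upwards [self_mem_nhdsWithin] with u hu
    refine ae_of_all _ fun x ↦ ?_
    have hu4 : 0 < u ^ 4 := by
      have : u ≠ 0 := hu
      positivity
    have h1 := Real.one_sub_sq_div_two_le_cos (x := u * x)
    have h2 := cos_le_one_sub_add_pow_four (u * x)
    rw [Real.norm_eq_abs, abs_of_nonneg (div_nonneg (by linarith) hu4.le), div_le_iff₀ hu4]
    calc _ ≤ (u * x) ^ 4 / 24 := by linarith
      _ = _ := by ring
  · refine ae_of_all _ fun x ↦ ?_
    rw [tendsto_iff_norm_sub_tendsto_zero]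
    have hc : Continuous fun u : ℝ ↦ |u| * |x| ^ 5 * Real.exp |u * x| := by fun_prop
    have hlim : Tendsto (fun u : ℝ ↦ |u| * |x| ^ 5 * Real.exp |u * x|) (𝓝[≠] 0) (𝓝 0) := by
      have := (hc.tendsto 0).mono_left (nhdsWithin_le_nhds (s := {0}ᶜ))
      simpa using this
    refine squeeze_zero' (Eventually.of_forall fun _ ↦ norm_nonneg _) ?_ hlim
    filter_upwards [self_mem_nhdsWithin] with u hu
    have hu0 : u ≠ 0 := hu
    have hu4 : 0 < u ^ 4 := by positivity
    have h := abs_cos_sub_le (u * x)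
    have e : (Real.cos (u * x) - 1 + (u * x) ^ 2 / 2) / u ^ 4 - x ^ 4 / 24
        = (Real.cos (u * x) - (1 - (u * x) ^ 2 / 2 + (u * x) ^ 4 / 24)) / u ^ 4 := by
      field_simp; ring
    rw [e, Real.norm_eq_abs, abs_div, abs_of_pos hu4, div_le_iff₀ hu4]
    refine h.trans_eq ?_
    have : u ^ 4 = |u| ^ 4 := (Even.pow_abs (by decide) u).symm
    rw [this, abs_mul]; ring

lemma integrable_of_abs_le_sq {D : Measure ℝ} (h2 : Integrable (fun x : ℝ ↦ x ^ 2) D)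
    {f : ℝ → ℝ} (hf : Measurable f) (C : ℝ) (hC : ∀ x, |f x| ≤ C * x ^ 2) : Integrable f D :=
  (h2.const_mul C).mono' hf.aestronglyMeasurable (ae_of_all _ fun x ↦ by simpa using hC x)

/-- Comparison of the fourth moment of a symmetric law with the fourth moment of its Lévy
measure, from the logarithm of the characteristic function. -/
lemma pow_four_moment_le_of_cos_eq {D ν : Measure ℝ} [IsProbabilityMeasure D]
    (hD4 : Integrable (fun x : ℝ ↦ x ^ 4) D) (hD2 : ∫ x, x ^ 2 ∂D = 2)
    (hν2 : Integrable (fun x : ℝ ↦ x ^ 2) ν) (hν4 : Integrable (fun x : ℝ ↦ x ^ 4) ν) {v : ℝ}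
    (h : ∀ u, ∫ x, Real.cos (u * x) ∂D
      = Real.exp (-v * u ^ 2 + 2 * ∫ x, (Real.cos (u * x) - 1) ∂ν)) :
    ∫ x, x ^ 4 ∂D ≤ 12 + 2 * ∫ x, x ^ 4 ∂ν := by
  set s := ∫ x, x ^ 2 ∂ν
  set k := ∫ x, x ^ 4 ∂ν
  set d := ∫ x, x ^ 4 ∂D
  have hDi2 := integrable_pow_of_le_four hD4 (j := 2) (by norm_num)
  have hDcos : ∀ u : ℝ, Integrable (fun x ↦ Real.cos (u * x)) D := fun u ↦
    (integrable_const (1 : ℝ)).mono' (by fun_prop) (ae_of_all _ fun x ↦ Real.abs_cos_le_one _)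
  have hνcos : ∀ u : ℝ, Integrable (fun x ↦ Real.cos (u * x) - 1) ν := fun u ↦
    integrable_of_abs_le_sq hν2 (by fun_prop) (u ^ 2 / 2) fun x ↦ by
      have h1 := Real.one_sub_sq_div_two_le_cos (x := u * x)
      have h2 := Real.cos_le_one (u * x)
      rw [abs_le]
      constructor <;> nlinarith
  -- the drift of the exponent
  have hlow : ∀ u : ℝ, -(s / 2) * u ^ 2 ≤ ∫ x, (Real.cos (u * x) - 1) ∂ν := fun u ↦ by
    have : -(s / 2) * u ^ 2 = ∫ x, -(u ^ 2 / 2) * x ^ 2 ∂ν := by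
      rw [integral_const_mul]; ring
    rw [this]
    refine integral_mono (hν2.const_mul _) (hνcos u) fun x ↦ ?_
    have h1 := Real.one_sub_sq_div_two_le_cos (x := u * x)
    simp only
    nlinarith
  have hupp : ∀ u : ℝ, ∫ x, (Real.cos (u * x) - 1) ∂ν ≤ -(s / 2) * u ^ 2 + k / 24 * u ^ 4 :=
    fun u ↦ by
    have : -(s / 2) * u ^ 2 + k / 24 * u ^ 4
        = ∫ x, (-(u ^ 2 / 2) * x ^ 2 + u ^ 4 / 24 * x ^ 4) ∂ν := by
      rw [integral_add (hν2.const_mul _) (hν4.const_mul _), integral_const_mul, integral_const_mul]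
      ring
    rw [this]
    refine integral_mono (hνcos u) ((hν2.const_mul _).add (hν4.const_mul _)) fun x ↦ ?_
    have h1 := cos_le_one_sub_add_pow_four (u * x)
    simp only
    nlinarith
  have hDupp : ∀ u : ℝ, ∫ x, Real.cos (u * x) ∂D ≤ 1 - u ^ 2 + d / 24 * u ^ 4 := fun u ↦ by
    have e := integral_quartic hD4 1 0 (-(u ^ 2 / 2)) 0 (u ^ 4 / 24)
    rw [hD2] at e
    calc _ ≤ _ := integral_mono (hDcos u) ?_ fun x ↦ ?_
      _ = _ := e
      _ = _ := by ring
    · refine integrable_of_abs_le_pow_four hD4 (by fun_prop) (1 + u ^ 2 / 2 + u ^ 4 / 24) fun x ↦ ?_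
      have h0 := abs_pow_le_one_add_pow_four x (j := 2) (by norm_num)
      rw [sq_abs] at h0
      have h4 : 0 ≤ x ^ 4 := by positivity
      have hu2 : 0 ≤ u ^ 2 := by positivity
      have hu4 : 0 ≤ u ^ 4 := by positivity
      rw [abs_le]
      constructor <;>
        nlinarith [mul_nonneg hu2 h4, mul_nonneg hu4 h4, mul_le_mul_of_nonneg_left h0 hu2,
          mul_nonneg hu2 (sq_nonneg x)]
    · have h1 := cos_le_one_sub_add_pow_four (u * x)
      simp only
      nlinarith
  -- Comparison at order `u²`: the exponent has leading term `-(v + s) u²` while `D` has variance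
  -- `2`. Only this direction of the equality is needed.
  have hvs : 1 ≤ v + s := by
    have hineq : ∀ u : ℝ, u ≠ 0 → 1 - (v + s) ≤ d / 24 * u ^ 2 := fun u hu ↦ by
      have h1 := hDupp u
      rw [h u] at h1
      have h2 := Real.add_one_le_exp (-v * u ^ 2 + 2 * ∫ x, (Real.cos (u * x) - 1) ∂ν)
      have h3 := hlow u
      have hu2 : 0 < u ^ 2 := by positivity
      have h4 : (1 - (v + s)) * u ^ 2 ≤ (d / 24 * u ^ 2) * u ^ 2 := by nlinarith
      exact le_of_mul_le_mul_right h4 hu2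
    have hlim : Tendsto (fun u : ℝ ↦ d / 24 * u ^ 2) (𝓝[≠] 0) (𝓝 0) := by
      have hc : Continuous fun u : ℝ ↦ d / 24 * u ^ 2 := by fun_prop
      have := (hc.tendsto 0).mono_left (nhdsWithin_le_nhds (s := {0}ᶜ))
      simpa using this
    have := ge_of_tendsto hlim (by
      filter_upwards [self_mem_nhdsWithin] with u hu using hineq u hu)
    linarith
  -- the fourth order term
  let w : ℝ → ℝ := fun u ↦ -1 + k / 12 * u ^ 2
  -- The exponent is at most `u² w(u)`. Expanding its exponential to second order, subtracting `1 -
  -- u²` and dividing by `u⁴` gives `R`, so the limit reads `d / 24 ≤ k / 12 + 1 / 2`.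
  let R : ℝ → ℝ := fun u ↦ k / 12 + w u ^ 2 / 2 + u ^ 2 * |w u| ^ 3 * Real.exp |u ^ 2 * w u|
  have hR : Tendsto R (𝓝[≠] 0) (𝓝 (k / 12 + 1 / 2)) := by
    have hc : Continuous R := by simp only [R, w]; fun_prop
    have := (hc.tendsto 0).mono_left (nhdsWithin_le_nhds (s := {0}ᶜ))
    simpa [R, w] using this
  have hbound : ∀ u : ℝ, u ≠ 0 →
      ∫ x, (Real.cos (u * x) - 1 + (u * x) ^ 2 / 2) / u ^ 4 ∂D ≤ R u := fun u hu ↦ by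
    have hu4 : 0 < u ^ 4 := by positivity
    have hi : Integrable (fun x ↦ Real.cos (u * x) - 1) D := (hDcos u).sub (integrable_const _)
    have e : ∫ x, (Real.cos (u * x) - 1 + (u * x) ^ 2 / 2) / u ^ 4 ∂D
        = (∫ x, Real.cos (u * x) ∂D - 1 + u ^ 2) / u ^ 4 := by
      rw [integral_div]
      congr 1
      simp_rw [mul_pow]
      rw [integral_add hi ((hDi2.const_mul _).div_const 2),
        integral_sub (hDcos u) (integrable_const _), integral_div, integral_const_mul, hD2]
      simp
    have h1 : -v * u ^ 2 + 2 * ∫ x, (Real.cos (u * x) - 1) ∂ν ≤ u ^ 2 * w u := by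
      have := hupp u
      have h2 : 0 ≤ u ^ 2 * (v + s - 1) := mul_nonneg (by positivity) (by linarith)
      simp only [w]
      nlinarith
    have h2 : Real.exp (u ^ 2 * w u)
        ≤ 1 + u ^ 2 * w u + (u ^ 2 * w u) ^ 2 / 2 + |u ^ 2 * w u| ^ 3 * Real.exp |u ^ 2 * w u| := by
      have h := Complex.norm_exp_sub_sum_le_norm_mul_exp ((u ^ 2 * w u : ℝ) : ℂ) 3
      rw [Complex.norm_real, Real.norm_eq_abs] at h
      have e3 : Complex.exp ((u ^ 2 * w u : ℝ) : ℂ)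
          - ∑ m ∈ Finset.range 3, ((u ^ 2 * w u : ℝ) : ℂ) ^ m / (m.factorial : ℂ)
          = ((Real.exp (u ^ 2 * w u) - (1 + u ^ 2 * w u + (u ^ 2 * w u) ^ 2 / 2) : ℝ) : ℂ) := by
        simp only [Finset.sum_range_succ, Finset.sum_range_zero, Nat.factorial]
        push_cast
        ring
      rw [e3, Complex.norm_real, Real.norm_eq_abs] at h
      linarith [le_abs_self (Real.exp (u ^ 2 * w u) - (1 + u ^ 2 * w u + (u ^ 2 * w u) ^ 2 / 2))]
    rw [e, h u, div_le_iff₀ hu4]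
    have h3 := Real.exp_le_exp.2 h1
    have e4 : R u * u ^ 4 = u ^ 2 * w u + u ^ 2 + (u ^ 2 * w u) ^ 2 / 2
        + |u ^ 2 * w u| ^ 3 * Real.exp |u ^ 2 * w u| := by
      simp only [R]
      rw [abs_mul (u ^ 2), abs_of_nonneg (sq_nonneg u)]
      have : k / 12 * u ^ 4 = u ^ 2 * w u + u ^ 2 := by simp only [w]; ring
      linear_combination this
    rw [e4]
    linarith
  have hfin := le_of_tendsto_of_tendsto (tendsto_integral_cos_remainder hD4) hR (by
    filter_upwards [self_mem_nhdsWithin] with u hu using hbound u hu)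
  rw [integral_div] at hfin
  change d / 24 ≤ k / 12 + 1 / 2 at hfin
  change d ≤ 12 + 2 * k
  linarith

/-- The fourth cumulant of a centred law of unit variance is at most the fourth moment of its Lévy
measure. -/
lemma HasLevyTriplet.pow_four_moment_sub_three_le {μ ν : Measure ℝ} [IsProbabilityMeasure μ]
    {b : ℝ} {v : ℝ≥0} (h : HasLevyTriplet μ b v ν) (h4 : Integrable (fun x : ℝ ↦ x ^ 4) μ)
    (h1 : ∫ x, x ∂μ = 0) (h2 : ∫ x, x ^ 2 ∂μ = 1) :
    ENNReal.ofReal (∫ x, x ^ 4 ∂μ - 3) ≤ ∫⁻ x, ENNReal.ofReal (x ^ 4) ∂ν := by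
  by_cases htop : ∫⁻ x, ENNReal.ofReal (x ^ 4) ∂ν = ∞
  · rw [htop]; exact le_top
  have hν4 : Integrable (fun x : ℝ ↦ x ^ 4) ν := by
    refine ⟨by fun_prop, ?_⟩
    rw [hasFiniteIntegral_iff_ofReal (ae_of_all _ fun x ↦ by positivity)]
    exact lt_top_iff_ne_top.2 htop
  have hνm : Integrable (fun x : ℝ ↦ min 1 (x ^ 2)) ν := by
    refine ⟨by fun_prop, ?_⟩
    rw [hasFiniteIntegral_iff_ofReal (ae_of_all _ fun x ↦ by positivity)]
    exact h.lintegral_min_lt_top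
  have hν2 : Integrable (fun x : ℝ ↦ x ^ 2) ν := by
    refine (hνm.add hν4).mono' (by fun_prop) (ae_of_all _ fun x ↦ ?_)
    simp only [Real.norm_eq_abs, Pi.add_apply]
    rw [abs_of_nonneg (by positivity)]
    rcases le_total (x ^ 2) 1 with hx | hx
    · rw [min_eq_right hx]
      have : 0 ≤ x ^ 4 := by positivity
      linarith
    · rw [min_eq_left hx]; nlinarith
  have hm : IsProbabilityMeasure (μ.map fun x ↦ -x) :=
    Measure.isProbabilityMeasure_map (by fun_prop)
  have hn4 := integrable_pow_four_map_neg h4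
  have hn1 : ∫ x, x ∂(μ.map fun x ↦ -x) = 0 := by rw [integral_id_map_neg, h1, neg_zero]
  have hn2 : ∫ x, x ^ 2 ∂(μ.map fun x ↦ -x) = 1 := by rw [integral_pow_map_neg (by decide), h2]
  have hn4' : ∫ x, x ^ 4 ∂(μ.map fun x ↦ -x) = ∫ x, x ^ 4 ∂μ := integral_pow_map_neg (by decide)
  -- The symmetrised law has characteristic function `|charFun μ|²`, free of drift and truncation
  -- terms. Its variance is `2` and its fourth moment `2 ∫ x⁴ dμ + 6`.
  set D := μ ∗ (μ.map fun x ↦ -x)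
  have hD4 : Integrable (fun x : ℝ ↦ x ^ 4) D := integrable_pow_four_conv h4 hn4
  have hD2 : ∫ x, x ^ 2 ∂D = 2 := by
    rw [integral_sq_conv h4 hn4 hn1, h2, hn2]; norm_num
  have hD4' : ∫ x, x ^ 4 ∂D = 2 * ∫ x, x ^ 4 ∂μ + 6 := by
    rw [integral_pow_four_conv h4 hn4 h1 hn1, h2, hn2, hn4']; ring
  have hcos : ∀ u : ℝ, ∫ x, Real.cos (u * x) ∂D
      = Real.exp (-v * u ^ 2 + 2 * ∫ x, (Real.cos (u * x) - 1) ∂ν) := fun u ↦ by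
    have c1 : charFun D u = ((‖charFun μ u‖ ^ 2 : ℝ) : ℂ) := by
      have e : (μ.map fun x ↦ -x) = μ.map fun x ↦ (-1) * x := by simp
      rw [charFun_conv, e, charFun_map_mul, neg_one_mul, charFun_neg, Complex.mul_conj,
        Complex.normSq_eq_norm_sq]
    have c2 : ∫ x, Real.cos (u * x) ∂D = (charFun D u).re := by
      rw [charFun_apply_real]
      have ie : Integrable (fun x : ℝ ↦ Complex.exp (u * x * Complex.I)) D := by
        refine (integrable_const (1 : ℝ)).mono' (by fun_prop) (ae_of_all _ fun x ↦ ?_)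
        have := Complex.norm_exp_ofReal_mul_I (u * x)
        push_cast at this
        rw [this]
      have := integral_re ie
      simp only [RCLike.re_eq_complex_re] at this
      rw [← this]
      refine integral_congr_ae (ae_of_all _ fun x ↦ ?_)
      have := Complex.exp_ofReal_mul_I_re (u * x)
      push_cast at this
      simp only
      rw [this]
    rw [c2, c1, Complex.ofReal_re, h.charFun_eq, Complex.norm_exp, ← Real.exp_nat_mul]
    congr 1
    have ii : Integrable (fun x : ℝ ↦ Complex.exp (Complex.I * u * x) - 1
        - Set.indicator (Set.Icc (-1 : ℝ) 1) (fun y : ℝ ↦ Complex.I * u * y) x) ν := by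
      refine (hν2.const_mul (2 * u ^ 2 + 2)).mono' ?_ (ae_of_all _ fun x ↦ ?_)
      · refine Measurable.aestronglyMeasurable ?_
        exact Measurable.sub (by fun_prop) (Measurable.indicator (by fun_prop) measurableSet_Icc)
      · by_cases hx : x ∈ Set.Icc (-1 : ℝ) 1
        · rw [Set.indicator_of_mem hx]
          have := norm_exp_I_mul_sub_one_sub_le (u * x)
          push_cast at this
          rw [← mul_assoc] at this
          refine this.trans ?_
          nlinarith [sq_nonneg x]
        · rw [Set.indicator_of_notMem hx, sub_zero]
          have hx1 : 1 ≤ x ^ 2 := by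
            rw [one_le_sq_iff_one_le_abs]
            by_contra hlt
            exact hx (abs_le.1 (not_le.1 hlt).le)
          have hn : ‖Complex.exp (Complex.I * u * x)‖ = 1 := by
            have := Complex.norm_exp_I_mul_ofReal (u * x)
            push_cast at this
            rwa [← mul_assoc] at this
          calc _ ≤ ‖Complex.exp (Complex.I * u * x)‖ + ‖(1 : ℂ)‖ := norm_sub_le _ _
            _ = 2 := by rw [hn, norm_one]; norm_num
            _ ≤ _ := by nlinarith [sq_nonneg u]
    have hre := integral_re ii
    simp only [RCLike.re_eq_complex_re] at hre
    have hre' : ∫ x, (Real.cos (u * x) - 1) ∂ν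
        = (∫ x, (Complex.exp (Complex.I * u * x) - 1
        - Set.indicator (Set.Icc (-1 : ℝ) 1) (fun y : ℝ ↦ Complex.I * u * y) x) ∂ν).re := by
      rw [← hre]
      refine integral_congr_ae (ae_of_all _ fun x ↦ ?_)
      have e1 := Complex.exp_ofReal_mul_I_re (u * x)
      push_cast at e1
      have e2 : Complex.I * u * x = u * x * Complex.I := by ring
      simp only [Complex.sub_re, e2, e1, Complex.one_re]
      by_cases hx : x ∈ Set.Icc (-1 : ℝ) 1
      · rw [Set.indicator_of_mem hx]; simp
      · rw [Set.indicator_of_notMem hx]; simp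
    rw [hre', Complex.add_re, Complex.sub_re]
    have e3 : (Complex.I * (b : ℂ) * u).re = 0 := by simp
    have e4 : ((v : ℂ) * (u : ℂ) ^ 2 / 2).re = v * u ^ 2 / 2 := by
      have : ((v : ℂ) * (u : ℂ) ^ 2 / 2) = ((v * u ^ 2 / 2 : ℝ) : ℂ) := by push_cast; rfl
      rw [this, Complex.ofReal_re]
    rw [e3, e4]
    push_cast
    ring
  have hfin := pow_four_moment_le_of_cos_eq hD4 hD2 hν2 hν4 hcos
  rw [hD4'] at hfin
  rw [← ofReal_integral_eq_lintegral_ofReal hν4 (ae_of_all _ fun x ↦ by positivity)]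
  exact ENNReal.ofReal_le_ofReal (by linarith)

end Cumulant

/-! ### One-dimensional laws of a Lévy process -/

section Laws

variable {Ω : Type*} [MeasurableSpace Ω] {P : Measure Ω} {X : ℝ≥0 → Ω → ℝ}

/-- `X (s + t)` is `X s` plus an independent increment with the law of `X t`. -/
lemma IsLevyProcess.map_add [IsProbabilityMeasure P] (hX : IsLevyProcess X P) (s t : ℝ≥0) :
    P.map (X (s + t)) = P.map (X s) ∗ P.map (X t) := by
  have hind := hX.indep_increments.indepFun_eval_sub (zero_le : 0 ≤ s)
    (le_self_add : s ≤ s + t) hX.start_zero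
  have h := hind.map_add_eq_map_conv_map₀ (hX.aemeasurable s)
    ((hX.aemeasurable _).sub (hX.aemeasurable _))
  rw [add_sub_cancel] at h
  rw [h]
  congr 1
  exact (hX.stationary_increments s t).map_eq

lemma IsLevyProcess.map_zero [IsProbabilityMeasure P] (hX : IsLevyProcess X P) :
    P.map (X 0) = Measure.dirac 0 := by
  have : X 0 =ᵐ[P] fun _ ↦ 0 := hX.start_zero
  rw [Measure.map_congr this, Measure.map_const, measure_univ, one_smul]

lemma IsLevyProcess.neg (hX : IsLevyProcess X P) : IsLevyProcess (-X) P where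
  aemeasurable t := (hX.aemeasurable t).neg
  start_zero := by
    filter_upwards [hX.start_zero] with ω h
    simp [h]
  indep_increments := hX.indep_increments.neg
  stationary_increments s h := by
    have := (hX.stationary_increments s h).comp measurable_neg
    have e : (fun ω ↦ (-X) (s + h) ω - (-X) s ω) = Neg.neg ∘ fun ω ↦ X (s + h) ω - X s ω := by
      funext ω
      simp only [Pi.neg_apply, Function.comp]
      ring
    rw [e]
    exact this
  cadlag := by
    filter_upwards [hX.cadlag] with ω h t
    obtain ⟨h1, l, h2⟩ := h t
    exact ⟨h1.neg, -l, h2.neg⟩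

/-- The law of a Lévy process along the grid of mesh `1 / n`. -/
noncomputable def gridLaw (X : ℝ≥0 → Ω → ℝ) (P : Measure Ω) (n i : ℕ) : Measure ℝ :=
  P.map (X ((i : ℝ≥0) / (n : ℝ≥0)))

lemma gridLaw_self {n : ℕ} (hn : n ≠ 0) : gridLaw X P n n = P.map (X 1) := by
  unfold gridLaw
  rw [div_self (by exact_mod_cast hn)]

lemma gridLaw_mul {m k : ℕ} (hm : m ≠ 0) (i : ℕ) :
    gridLaw X P (m * k) (m * i) = gridLaw X P k i := by
  unfold gridLaw
  push_cast
  rw [mul_div_mul_left _ _ (by exact_mod_cast hm)]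

variable [IsProbabilityMeasure P]

lemma IsLevyProcess.isProbabilityMeasure_map (hX : IsLevyProcess X P) (t : ℝ≥0) :
    IsProbabilityMeasure (P.map (X t)) :=
  Measure.isProbabilityMeasure_map (hX.aemeasurable t)

lemma IsLevyProcess.gridLaw_zero (hX : IsLevyProcess X P) (n : ℕ) :
    gridLaw X P n 0 = Measure.dirac 0 := by
  simp [gridLaw, hX.map_zero]

lemma IsLevyProcess.gridLaw_succ (hX : IsLevyProcess X P) (n i : ℕ) :
    gridLaw X P n (i + 1) = gridLaw X P n i ∗ gridLaw X P n 1 := by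
  unfold gridLaw
  rw [← hX.map_add]
  congr 2
  push_cast
  rw [add_div]

/-- The law at time `t` is a convolution factor of the law at time `1`. -/
lemma IsLevyProcess.integrable_pow_four_map (hX : IsLevyProcess X P)
    (h4 : Integrable (fun x : ℝ ↦ x ^ 4) (P.map (X 1))) {t : ℝ≥0} (ht : t ≤ 1) :
    Integrable (fun x : ℝ ↦ x ^ 4) (P.map (X t)) := by
  have := hX.isProbabilityMeasure_map
  refine integrable_pow_four_of_conv (μ := P.map (X (1 - t))) ?_
  rw [← hX.map_add, tsub_add_cancel_of_le ht]
  exact h4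

lemma IsLevyProcess.integrable_pow_four_gridLaw (hX : IsLevyProcess X P)
    (h4 : Integrable (fun x : ℝ ↦ x ^ 4) (P.map (X 1))) {n : ℕ} (hn : n ≠ 0) (i : ℕ) :
    Integrable (fun x : ℝ ↦ x ^ 4) (gridLaw X P n i) := by
  have hp := hX.isProbabilityMeasure_map
  have (i : ℕ) : IsProbabilityMeasure (gridLaw X P n i) := hp _
  induction i with
  | zero => rw [hX.gridLaw_zero]; exact integrable_dirac (by simp)
  | succ i ih =>
    rw [hX.gridLaw_succ]
    refine integrable_pow_four_conv ih (hX.integrable_pow_four_map h4 ?_)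
    rw [Nat.cast_one]
    refine div_le_one_of_le₀ ?_ zero_le
    exact_mod_cast Nat.one_le_iff_ne_zero.2 hn

/-- Moments of the increments over the grid of mesh `1 / n`, for a centred Lévy process of unit
variance. -/
lemma IsLevyProcess.moments_gridLaw_one (hX : IsLevyProcess X P)
    (h4 : Integrable (fun x : ℝ ↦ x ^ 4) (P.map (X 1))) (h1 : ∫ x, x ∂(P.map (X 1)) = 0)
    (h2 : ∫ x, x ^ 2 ∂(P.map (X 1)) = 1) {n : ℕ} (hn : n ≠ 0) :
    ∫ x, x ∂(gridLaw X P n 1) = 0 ∧ ∫ x, x ^ 2 ∂(gridLaw X P n 1) = 1 / n ∧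
      ∫ x, x ^ 4 ∂(gridLaw X P n 1) = (∫ x, x ^ 4 ∂(P.map (X 1)) - 3 + 3 / n) / n := by
  have hp := hX.isProbabilityMeasure_map
  have (i : ℕ) : IsProbabilityMeasure (gridLaw X P n i) := hp _
  have hA4 := hX.integrable_pow_four_gridLaw h4 hn
  have hn0 : (n : ℝ) ≠ 0 := by exact_mod_cast hn
  have e1 := integral_id_semigroup hA4 (hX.gridLaw_zero n) (hX.gridLaw_succ n) n
  rw [gridLaw_self hn, h1] at e1
  have m1 : ∫ x, x ∂(gridLaw X P n 1) = 0 :=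
    (mul_eq_zero.1 e1.symm).resolve_left hn0
  have e2 := integral_sq_semigroup hA4 (hX.gridLaw_zero n) (hX.gridLaw_succ n) m1 n
  rw [gridLaw_self hn, h2] at e2
  have m2 : ∫ x, x ^ 2 ∂(gridLaw X P n 1) = 1 / n := by rw [e2]; field_simp
  have e4 := integral_pow_four_semigroup hA4 (hX.gridLaw_zero n) (hX.gridLaw_succ n) m1 n
  rw [gridLaw_self hn, m2] at e4
  refine ⟨m1, m2, ?_⟩
  rw [e4]
  field_simp
  ring

/-- Infinite divisibility: the nonnegative fourth moment at time `1 / n` equals `(κ + 3 / n) / n`;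
let `n` tend to infinity. -/
lemma IsLevyProcess.fourth_cumulant_nonneg (hX : IsLevyProcess X P)
    (h4 : Integrable (fun x : ℝ ↦ x ^ 4) (P.map (X 1))) (h1 : ∫ x, x ∂(P.map (X 1)) = 0)
    (h2 : ∫ x, x ^ 2 ∂(P.map (X 1)) = 1) : 0 ≤ ∫ x, x ^ 4 ∂(P.map (X 1)) - 3 := by
  have hlim : Tendsto (fun n : ℕ ↦ ∫ x, x ^ 4 ∂(P.map (X 1)) - 3 + 3 / (n : ℝ)) atTop
      (𝓝 (∫ x, x ^ 4 ∂(P.map (X 1)) - 3 + 0)) :=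
    tendsto_const_nhds.add (tendsto_const_div_atTop_nhds_zero_nat 3)
  rw [add_zero] at hlim
  refine ge_of_tendsto hlim ?_
  filter_upwards [eventually_ne_atTop 0] with n hn
  have h := (hX.moments_gridLaw_one h4 h1 h2 hn).2.2
  have hn0 : (0 : ℝ) < n := by positivity
  have h0 : 0 ≤ ∫ x, x ^ 4 ∂(gridLaw X P n 1) := integral_nonneg fun x ↦ by positivity
  rw [h] at h0
  by_contra hlt
  exact absurd h0 (not_le.2 (div_neg_of_neg_of_pos (not_le.1 hlt) hn0))

/-- The law at time `1` of a centred Lévy process of unit variance with a finite fourth moment has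
a Lévy–Khintchine representation. -/
lemma IsLevyProcess.exists_hasLevyTriplet (hX : IsLevyProcess X P)
    (h4 : Integrable (fun x : ℝ ↦ x ^ 4) (P.map (X 1))) (h1 : ∫ x, x ∂(P.map (X 1)) = 0)
    (h2 : ∫ x, x ^ 2 ∂(P.map (X 1)) = 1) :
    ∃ ν : Measure ℝ, ∃ (b : ℝ) (v : ℝ≥0), HasLevyTriplet (P.map (X 1)) b v ν := by
  have hp := hX.isProbabilityMeasure_map
  have hp' (n i : ℕ) : IsProbabilityMeasure (gridLaw X P n i) := hp _
  have hm (n : ℕ) := hX.moments_gridLaw_one h4 h1 h2 n.succ_ne_zero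
  refine _root_.exists_hasLevyTriplet (fun n ↦ gridLaw X P (n + 1) 1) (fun n u ↦ ?_)
    (fun n ↦ hX.integrable_pow_four_gridLaw h4 n.succ_ne_zero 1) (fun n ↦ (hm n).1)
    (fun n ↦ by simpa using (hm n).2.1) (K := ∫ x, x ^ 4 ∂(P.map (X 1))) (fun n ↦ ?_)
  · have hpow : ∀ i : ℕ, charFun (gridLaw X P (n + 1) i) u
        = charFun (gridLaw X P (n + 1) 1) u ^ i := fun i ↦ by
      induction i with
      | zero => simp [hX.gridLaw_zero]
      | succ i ih => rw [hX.gridLaw_succ, charFun_conv, ih, pow_succ]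
    rw [← hpow, gridLaw_self n.succ_ne_zero]
  · have h := (hm n).2.2
    rw [h]
    push_cast
    have hn : (0 : ℝ) < n + 1 := by positivity
    have : 3 / ((n : ℝ) + 1) ≤ 3 := div_le_self (by norm_num) (by linarith [n.cast_nonneg (α := ℝ)])
    rw [mul_div_cancel₀ _ hn.ne']
    linarith

/-- Existence of a triplet excludes the default value `0` in `levyMeasure`; the bound holds for
every triplet, hence for the chosen one. -/
lemma IsLevyProcess.ofReal_fourth_cumulant_le (hX : IsLevyProcess X P)
    (h4 : Integrable (fun x : ℝ ↦ x ^ 4) (P.map (X 1))) (h1 : ∫ x, x ∂(P.map (X 1)) = 0)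
    (h2 : ∫ x, x ^ 2 ∂(P.map (X 1)) = 1) :
    ENNReal.ofReal (∫ x, x ^ 4 ∂(P.map (X 1)) - 3) ≤ levyFourthMoment X P := by
  have := hX.isProbabilityMeasure_map
  have hex := hX.exists_hasLevyTriplet h4 h1 h2
  unfold levyFourthMoment levyMeasure
  rw [dif_pos hex]
  obtain ⟨b, v, h⟩ := hex.choose_spec
  exact h.pow_four_moment_sub_three_le h4 h1 h2

/-- Overshoots of an increment over time `1 / k` above the level `(1 + √(2 log k)) / √k`. -/
lemma IsLevyProcess.integral_posPart_pow_four_le (hX : IsLevyProcess X P)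
    (h4 : Integrable (fun x : ℝ ↦ x ^ 4) (P.map (X 1))) (h1 : ∫ x, x ∂(P.map (X 1)) = 0)
    (h2 : ∫ x, x ^ 2 ∂(P.map (X 1)) = 1) {k : ℕ} (hk : 2 ≤ k)
    (hκ : k * (∫ x, x ^ 4 ∂(P.map (X 1)) - 3) ≤ 1) {r c : ℝ} (hr : r = 1 / √k)
    (hc : c = (1 + √(2 * Real.log k)) * r) :
    ∫ x, (max (x - c) 0) ^ 4 ∂(gridLaw X P k 1)
      ≤ 143 * (∫ x, x ^ 4 ∂(P.map (X 1)) - 3 + 1 / k ^ 2) / k := by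
  have hp := hX.isProbabilityMeasure_map
  have hp' (n i : ℕ) : IsProbabilityMeasure (gridLaw X P n i) := hp _
  have hm : 100 * k ≠ 0 := by omega
  -- Mesh `1 / (100 k²)`, so that `100 k` steps make up time `1 / k`.
  have hn : 100 * k * k ≠ 0 := by positivity
  obtain ⟨m1, m2, m4⟩ := hX.moments_gridLaw_one h4 h1 h2 hn
  have h := integral_posPart_pow_four_le_of_semigroup (m := 100 * k)
    (hX.integrable_pow_four_gridLaw h4 hn) (hX.gridLaw_zero _) (hX.gridLaw_succ _) m1 hk rfl
    (by rw [m2]; push_cast; rfl) (hX.fourth_cumulant_nonneg h4 h1 h2) hκ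
    (by rw [m4]; push_cast; rfl) hr hc
  have e := gridLaw_mul (X := X) (P := P) (k := k) hm 1
  rw [mul_one] at e
  rwa [e] at h

/-- Above `c = d + r` the overshoot over `d` is at least `r`, and `k r² = 1`, so squares over `c`
are at most `k` times fourth powers over `d`. The lower tail is the upper tail of `-X`, whence `286
= 2 * 143`. -/
lemma IsLevyProcess.integral_overshoot_sq_le (hX : IsLevyProcess X P)
    (h4 : Integrable (fun x : ℝ ↦ x ^ 4) (P.map (X 1))) (h1 : ∫ x, x ∂(P.map (X 1)) = 0)
    (h2 : ∫ x, x ^ 2 ∂(P.map (X 1)) = 1) {k : ℕ} (hk : 2 ≤ k)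
    (hκ : k * (∫ x, x ^ 4 ∂(P.map (X 1)) - 3) ≤ 1) {r c : ℝ} (hr : r = 1 / √k)
    (hc : c = (2 + √(2 * Real.log k)) * r) :
    ∫ x, (overshoot c x) ^ 2 ∂(gridLaw X P k 1)
      ≤ 286 * (∫ x, x ^ 4 ∂(P.map (X 1)) - 3 + 1 / k ^ 2) := by
  have hp := hX.isProbabilityMeasure_map
  have hp' (n i : ℕ) : IsProbabilityMeasure (gridLaw X P n i) := hp _
  have hk0 : (0 : ℝ) < k := by positivity
  have hr0 : 0 < r := by rw [hr]; positivity
  have hr2 : r ^ 2 = 1 / k := by rw [hr, div_pow, Real.sq_sqrt hk0.le, one_pow]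
  set d : ℝ := (1 + √(2 * Real.log k)) * r with hd
  have hd0 : 0 ≤ d := by positivity
  have hcd : c = d + r := by rw [hc, hd]; ring
  have hneg : ∀ t, P.map ((-X) t) = (P.map (X t)).map (fun x ↦ -x) := fun t ↦ by
    rw [AEMeasurable.map_map_of_aemeasurable (by fun_prop) (hX.aemeasurable t)]
    rfl
  have n1 : ∫ x, x ∂(P.map ((-X) 1)) = 0 := by rw [hneg, integral_id_map_neg, h1, neg_zero]
  have n2 : ∫ x, x ^ 2 ∂(P.map ((-X) 1)) = 1 := by
    rw [hneg, integral_pow_map_neg (by decide), h2]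
  have n4 : ∫ x, x ^ 4 ∂(P.map ((-X) 1)) = ∫ x, x ^ 4 ∂(P.map (X 1)) := by
    rw [hneg, integral_pow_map_neg (by decide)]
  have hn4 : Integrable (fun x : ℝ ↦ x ^ 4) (P.map ((-X) 1)) := by
    rw [hneg]; exact integrable_pow_four_map_neg h4
  have b1 := hX.integral_posPart_pow_four_le h4 h1 h2 hk hκ hr hd
  have b2 := hX.neg.integral_posPart_pow_four_le hn4 n1 n2 hk (by rw [n4]; exact hκ) hr hd
  rw [n4] at b2
  have hk' : k ≠ 0 := by omega
  have hg4 := hX.integrable_pow_four_gridLaw h4 hk' 1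
  have e2 : ∫ x, (max (x - d) 0) ^ 4 ∂(gridLaw (-X) P k 1)
      = ∫ x, (max (-x - d) 0) ^ 4 ∂(gridLaw X P k 1) := by
    unfold gridLaw
    rw [hneg, integral_map (by fun_prop) (by fun_prop)]
  rw [e2] at b2
  have i1 : Integrable (fun x ↦ (max (x - d) 0) ^ 4) (gridLaw X P k 1) := by
    have := integrable_posPart_pow_four hg4 (-d)
    simpa only [neg_add_eq_sub] using this
  have i2 : Integrable (fun x ↦ (max (-x - d) 0) ^ 4) (gridLaw X P k 1) :=
    integrable_of_abs_le_pow_four hg4 (by fun_prop) (8 * (1 + d ^ 4)) fun x ↦ by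
      have := abs_posPart_pow_four_le (-d) (-x)
      calc _ = |(max (-d + -x) 0) ^ 4| := by rw [neg_add_eq_sub, neg_sub_comm]
        _ ≤ _ := this
        _ = _ := by ring
  have hov : ∀ x, (overshoot c x) ^ 2
      ≤ k * ((max (x - d) 0) ^ 4 + (max (-x - d) 0) ^ 4) := fun x ↦ by
    have key : ∀ y : ℝ, (max (y - c) 0) ^ 2 ≤ k * (max (y - d) 0) ^ 4 := fun y ↦ by
      rcases le_total y c with hy | hy
      · rw [max_eq_right (by linarith : y - c ≤ 0)]
        simp only [ne_eq, OfNat.ofNat_ne_zero, not_false_eq_true, zero_pow]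
        positivity
      · have hyd : r ≤ y - d := by rw [hcd] at hy; linarith
        rw [max_eq_left (by linarith : 0 ≤ y - c), max_eq_left (by linarith : 0 ≤ y - d)]
        have hkr : (k : ℝ) * r ^ 2 = 1 := by rw [hr2]; field_simp
        have h3 : (y - c) ^ 2 ≤ (y - d) ^ 2 := by
          apply pow_le_pow_left₀ (by linarith); linarith
        have h4 : r ^ 2 ≤ (y - d) ^ 2 := pow_le_pow_left₀ hr0.le hyd 2
        calc (y - c) ^ 2 ≤ (k * r ^ 2) * (y - d) ^ 2 := by rw [hkr, one_mul]; exact h3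
          _ ≤ (k * (y - d) ^ 2) * (y - d) ^ 2 := by gcongr
          _ = _ := by ring
    unfold overshoot
    have p1 : 0 ≤ (k : ℝ) * (max (x - d) 0) ^ 4 := by positivity
    have p2 : 0 ≤ (k : ℝ) * (max (-x - d) 0) ^ 4 := by positivity
    rw [mul_add]
    rcases abs_choice x with hx | hx <;> rw [hx]
    · linarith [key x]
    · linarith [key (-x)]
  have hi : Integrable (fun x ↦ (overshoot c x) ^ 2) (gridLaw X P k 1) :=
    ((i1.add i2).const_mul (k : ℝ)).mono' (by
      exact ((measurable_overshoot c).pow_const 2).aestronglyMeasurable)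
      (ae_of_all _ fun x ↦ by
        rw [Real.norm_eq_abs, abs_of_nonneg (by positivity)]; exact hov x)
  calc _ ≤ ∫ x, (k : ℝ) * ((max (x - d) 0) ^ 4 + (max (-x - d) 0) ^ 4) ∂(gridLaw X P k 1) :=
        integral_mono hi ((i1.add i2).const_mul _) hov
    _ = k * (∫ x, (max (x - d) 0) ^ 4 ∂(gridLaw X P k 1)
        + ∫ x, (max (-x - d) 0) ^ 4 ∂(gridLaw X P k 1)) := by
        rw [integral_const_mul, integral_add i1 i2]
    _ ≤ k * (143 * (∫ x, x ^ 4 ∂(P.map (X 1)) - 3 + 1 / k ^ 2) / k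
        + 143 * (∫ x, x ^ 4 ∂(P.map (X 1)) - 3 + 1 / k ^ 2) / k) := by gcongr
    _ = _ := by field_simp; ring

end Laws

/-! ### Oscillations of the paths over a grid -/

section Paths

variable {Ω : Type*} {X : ℝ≥0 → Ω → ℝ}

/-- The largest overshoot above `c` of the increments of the path over `[j / k, (j + 1) / k]` from
the left end point, along the grid that divides this interval into `n` parts. -/
noncomputable def blockOvershoot (X : ℝ≥0 → Ω → ℝ) (c : ℝ) (k n j : ℕ) (ω : Ω) : ℝ :=
  partialSups (fun i : ℕ ↦
    overshoot c (X ((n * j + i : ℕ) / (n * k : ℕ)) ω - X ((j : ℝ≥0) / (k : ℝ≥0)) ω)) n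

lemma sq_le_of_overshoot_le {c y z : ℝ} (h : overshoot c y ≤ z) :
    y ^ 2 ≤ 2 * c ^ 2 + 2 * z ^ 2 := by
  have h1 : |y| ≤ c + z := by
    have := le_max_left (|y| - c) 0
    unfold overshoot at h
    linarith
  rw [← sq_abs]
  have h2 : |y| ^ 2 ≤ (c + z) ^ 2 := pow_le_pow_left₀ (abs_nonneg y) h1 2
  nlinarith [sq_nonneg (c - z)]

/-- A bound for the squared oscillations over the grid of mesh `1 / (n k)`. -/
noncomputable def gridBound (X : ℝ≥0 → Ω → ℝ) (c : ℝ) (k n : ℕ) (ω : Ω) : ℝ≥0∞ :=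
  ENNReal.ofReal (2 * c ^ 2)
    + ∑ j ∈ Finset.range k, 2 * ENNReal.ofReal (blockOvershoot X c k n j ω ^ 2)

/-- The maximum over the blocks is replaced by a sum. The resulting factor `k` is affordable because
overshoots over a high level are rare. -/
lemma ofReal_sq_le_gridBound (c : ℝ) {k n i j : ℕ} (hj : j < k) (hi : i ≤ n) (ω : Ω) :
    ENNReal.ofReal ((X ((n * j + i : ℕ) / (n * k : ℕ)) ω - X ((j : ℝ≥0) / (k : ℝ≥0)) ω) ^ 2)
      ≤ gridBound X c k n ω := by
  have h := le_partialSups_of_le (fun i : ℕ ↦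
    overshoot c (X ((n * j + i : ℕ) / (n * k : ℕ)) ω - X ((j : ℝ≥0) / (k : ℝ≥0)) ω)) hi
  have h' := sq_le_of_overshoot_le h
  calc _ ≤ ENNReal.ofReal (2 * c ^ 2 + 2 * blockOvershoot X c k n j ω ^ 2) :=
        ENNReal.ofReal_le_ofReal h'
    _ = ENNReal.ofReal (2 * c ^ 2) + 2 * ENNReal.ofReal (blockOvershoot X c k n j ω ^ 2) := by
        rw [ENNReal.ofReal_add (by positivity) (by positivity), ENNReal.ofReal_mul (by norm_num)]
        simp
    _ ≤ _ := by
        unfold gridBound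
        gcongr
        exact Finset.single_le_sum
          (f := fun j ↦ 2 * ENNReal.ofReal (blockOvershoot X c k n j ω ^ 2))
          (fun _ _ ↦ zero_le) (Finset.mem_range.2 hj)

/-- For a right-continuous path, the oscillation at time `t` is controlled along the grids. -/
lemma ofReal_sq_sub_discretize_le_liminf {ω : Ω}
    (hω : ∀ t : ℝ≥0, ContinuousWithinAt (fun s ↦ X s ω) (Set.Ici t) t) (c : ℝ)
    {k : ℕ} (hk : k ≠ 0) {t : ℝ≥0} (ht : t ≤ 1) :
    ENNReal.ofReal ((X t ω - discretize k (fun s ↦ X s ω) t) ^ 2)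
      ≤ liminf (fun n : ℕ ↦ gridBound X c k (n + 1) ω) atTop := by
  have hk0 : (0 : ℝ≥0) < k := by positivity
  unfold discretize
  -- At `t = 1` the floor is `k`, which is the index of no block, but the oscillation vanishes
  -- there.
  rcases ht.eq_or_lt with rfl | ht
  · have : ((⌊(k : ℝ≥0) * 1⌋₊ : ℝ≥0) / (k : ℝ≥0)) = 1 := by
      rw [mul_one, Nat.floor_natCast, div_self hk0.ne']
    rw [this]
    simp
  set j := ⌊(k : ℝ≥0) * t⌋₊ with hj
  have hjle : (j : ℝ≥0) ≤ k * t := Nat.floor_le zero_le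
  have hjlt : (k : ℝ≥0) * t < j + 1 := Nat.lt_floor_add_one _
  have hjk : j < k := by
    have : (j : ℝ≥0) < k := hjle.trans_lt (mul_lt_of_lt_one_right hk0 ht)
    exact_mod_cast this
  -- Rounding up places the grid points `τ n` at or to the right of `t`, where the path is
  -- continuous; `i n ≤ n + 1` keeps them in the closed block.
  let i : ℕ → ℕ := fun n ↦ ⌈((n + 1 : ℕ) : ℝ≥0) * (k * t - j)⌉₊
  let τ : ℕ → ℝ≥0 := fun n ↦ ((n + 1) * j + i n : ℕ) / ((n + 1) * k : ℕ)
  have hi : ∀ n, i n ≤ n + 1 := fun n ↦ by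
    refine Nat.ceil_le.2 ?_
    have : (k : ℝ≥0) * t - j ≤ 1 := tsub_le_iff_left.2 hjlt.le
    exact mul_le_of_le_one_right zero_le this
  have hτge : ∀ n, t ≤ τ n := fun n ↦ by
    simp only [τ]
    rw [le_div_iff₀ (by positivity)]
    have h := Nat.le_ceil (((n + 1 : ℕ) : ℝ≥0) * (k * t - j))
    have e : t * (((n + 1) * k : ℕ) : ℝ≥0)
        = ((n + 1 : ℕ) : ℝ≥0) * j + ((n + 1 : ℕ) : ℝ≥0) * (k * t - j) := by
      rw [← mul_add, add_tsub_cancel_of_le hjle]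
      push_cast; ring
    rw [e, Nat.cast_add (_ * _), Nat.cast_mul]
    exact add_le_add le_rfl h
  have hτle : ∀ n, τ n ≤ t + 1 / ((n : ℝ≥0) + 1) := fun n ↦ by
    simp only [τ]
    rw [div_le_iff₀ (by positivity)]
    have h := (Nat.ceil_lt_add_one (a := ((n + 1 : ℕ) : ℝ≥0) * (k * t - j)) zero_le).le
    have e : t * (((n + 1) * k : ℕ) : ℝ≥0)
        = ((n + 1 : ℕ) : ℝ≥0) * j + ((n + 1 : ℕ) : ℝ≥0) * (k * t - j) := by
      rw [← mul_add, add_tsub_cancel_of_le hjle]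
      push_cast; ring
    have hk1 : (1 : ℝ≥0) ≤ k := by exact_mod_cast Nat.one_le_iff_ne_zero.2 hk
    have e1 : 1 / ((n : ℝ≥0) + 1) * (((n + 1) * k : ℕ) : ℝ≥0) = k := by
      push_cast; field_simp
    rw [add_mul t, e, e1, Nat.cast_add, Nat.cast_mul, add_assoc]
    exact add_le_add le_rfl (h.trans (add_le_add le_rfl hk1))
  have hτlim : Tendsto τ atTop (𝓝 t) := by
    refine tendsto_of_tendsto_of_tendsto_of_le_of_le tendsto_const_nhds ?_ hτge hτle
    have := (tendsto_one_div_add_atTop_nhds_zero_nat (𝕜 := ℝ≥0)).const_add t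
    simpa using this
  have hXlim : Tendsto (fun n ↦ X (τ n) ω) atTop (𝓝 (X t ω)) :=
    (hω t).tendsto.comp (tendsto_nhdsWithin_iff.2 ⟨hτlim, Eventually.of_forall hτge⟩)
  have hlim : Tendsto (fun n ↦ ENNReal.ofReal ((X (τ n) ω - X ((j : ℝ≥0) / (k : ℝ≥0)) ω) ^ 2)) atTop
      (𝓝 (ENNReal.ofReal ((X t ω - X ((j : ℝ≥0) / (k : ℝ≥0)) ω) ^ 2))) :=
    ENNReal.tendsto_ofReal ((hXlim.sub_const _).pow 2)
  rw [← hlim.liminf_eq]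
  exact liminf_le_liminf (Eventually.of_forall fun n ↦ ofReal_sq_le_gridBound c hjk (hi n) ω)

variable [MeasurableSpace Ω] {P : Measure Ω}

lemma aemeasurable_blockOvershoot (hX : IsLevyProcess X P) (c : ℝ) (k n j : ℕ) :
    AEMeasurable (blockOvershoot X c k n j) P := by
  have h : ∀ m : ℕ, AEMeasurable (fun ω ↦ partialSups (fun i : ℕ ↦
      overshoot c (X ((n * j + i : ℕ) / (n * k : ℕ)) ω - X ((j : ℝ≥0) / (k : ℝ≥0)) ω)) m) P := by
    have h0 : ∀ i : ℕ, AEMeasurable (fun ω ↦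
        overshoot c (X ((n * j + i : ℕ) / (n * k : ℕ)) ω - X ((j : ℝ≥0) / (k : ℝ≥0)) ω)) P :=
      fun i ↦ (measurable_overshoot c).comp_aemeasurable
        ((hX.aemeasurable _).sub (hX.aemeasurable _))
    intro m
    induction m with
    | zero => simpa using h0 0
    | succ m ih =>
      simp_rw [partialSups_add_one]
      exact ih.sup (h0 _)
  exact h n

variable [IsProbabilityMeasure P]

/-- Grid increments within a block form a centred random walk ending at an increment over time `1 /
k`, so Doob's bound does not depend on `n`. -/
lemma IsLevyProcess.lintegral_blockOvershoot_sq_le (hX : IsLevyProcess X P)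
    (h4 : Integrable (fun x : ℝ ↦ x ^ 4) (P.map (X 1))) (h1 : ∫ x, x ∂(P.map (X 1)) = 0)
    (h2 : ∫ x, x ^ 2 ∂(P.map (X 1)) = 1) {c : ℝ} (hc : 0 ≤ c) {k n : ℕ} (hk : k ≠ 0) (hn : n ≠ 0)
    (j : ℕ) :
    ∫⁻ ω, ENNReal.ofReal (blockOvershoot X c k n j ω ^ 2) ∂P
      ≤ ENNReal.ofReal (4 * ∫ x, (overshoot c x) ^ 2 ∂(gridLaw X P k 1)) := by
  let τ : ℕ → ℝ≥0 := fun i ↦ (n * j + i : ℕ) / (n * k : ℕ)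
  have hnk : n * k ≠ 0 := mul_ne_zero hn hk
  have hτ : Monotone τ := fun a b hab ↦ by
    simp only [τ]
    gcongr
  let ξ : ℕ → Ω → ℝ := fun i ω ↦ X (τ (i + 1)) ω - X (τ i) ω
  have hind : iIndepFun ξ P := hX.indep_increments.nat hτ
  have hstep : ∀ i, τ (i + 1) = τ i + (1 : ℕ) / (n * k : ℕ) := fun i ↦ by
    simp only [τ]
    rw [← add_div]
    push_cast
    ring_nf
  have hid : ∀ i, IdentDistrib (ξ i) (X ((1 : ℕ) / (n * k : ℕ))) P P := fun i ↦ by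
    have := hX.stationary_increments (τ i) ((1 : ℕ) / (n * k : ℕ))
    rw [← hstep] at this
    exact this
  have hg4 := hX.integrable_pow_four_gridLaw h4 hnk 1
  have hp := hX.isProbabilityMeasure_map
  have : IsProbabilityMeasure (gridLaw X P (n * k) 1) := hp _
  have hL2 : ∀ i, MemLp (ξ i) 2 P := fun i ↦ by
    rw [(hid i).memLp_iff, memLp_two_iff_integrable_sq (hX.aemeasurable _).aestronglyMeasurable]
    have := integrable_pow_of_le_four hg4 (j := 2) (by norm_num)
    rwa [gridLaw, integrable_map_measure (by fun_prop) (hX.aemeasurable _)] at this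
  have hmean : ∀ i, ∫ ω, ξ i ω ∂P = 0 := fun i ↦ by
    rw [(hid i).integral_eq]
    have := (hX.moments_gridLaw_one h4 h1 h2 hnk).1
    rwa [gridLaw, integral_map (hX.aemeasurable _) (by fun_prop)] at this
  have hτ0 : τ 0 = (j : ℝ≥0) / (k : ℝ≥0) := by
    simp only [τ, add_zero]
    push_cast
    rw [mul_div_mul_left _ _ (by exact_mod_cast hn)]
  have hsum : ∀ i ω, ∑ l ∈ Finset.range i, ξ l ω = X (τ i) ω - X ((j : ℝ≥0) / (k : ℝ≥0)) ω :=
    fun i ω ↦ by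
    rw [← hτ0]
    exact Finset.sum_range_sub (fun l ↦ X (τ l) ω) i
  have h := lintegral_partialSups_overshoot_le hind hL2 hmean hc n
  simp_rw [hsum] at h
  have hτn : τ n = (j : ℝ≥0) / (k : ℝ≥0) + (1 : ℕ) / (k : ℝ≥0) := by
    simp only [τ]
    rw [← add_div, show n * j + n = n * (j + 1) by ring]
    push_cast
    rw [mul_div_mul_left _ _ (by exact_mod_cast hn)]
  have hend : ∫ ω, (overshoot c (X (τ n) ω - X ((j : ℝ≥0) / (k : ℝ≥0)) ω)) ^ 2 ∂P
      = ∫ x, (overshoot c x) ^ 2 ∂(gridLaw X P k 1) := by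
    have hm : Measurable fun x ↦ (overshoot c x) ^ 2 := (measurable_overshoot c).pow_const 2
    have := ((hX.stationary_increments ((j : ℝ≥0) / (k : ℝ≥0)) ((1 : ℕ) / (k : ℝ≥0))).comp
      hm).integral_eq
    rw [hτn, gridLaw, integral_map (hX.aemeasurable _) hm.aestronglyMeasurable]
    exact this
  rw [hend] at h
  exact h

lemma IsLevyProcess.lintegral_gridBound_le (hX : IsLevyProcess X P)
    (h4 : Integrable (fun x : ℝ ↦ x ^ 4) (P.map (X 1))) (h1 : ∫ x, x ∂(P.map (X 1)) = 0)
    (h2 : ∫ x, x ^ 2 ∂(P.map (X 1)) = 1) {c : ℝ} (hc : 0 ≤ c) {k n : ℕ} (hk : k ≠ 0)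
    (hn : n ≠ 0) :
    ∫⁻ ω, gridBound X c k n ω ∂P
      ≤ ENNReal.ofReal (2 * c ^ 2 + 8 * k * ∫ x, (overshoot c x) ^ 2 ∂(gridLaw X P k 1)) := by
  have hm : ∀ j, AEMeasurable (fun ω ↦ ENNReal.ofReal (blockOvershoot X c k n j ω ^ 2)) P :=
    fun j ↦ ((aemeasurable_blockOvershoot hX c k n j).pow_const 2).ennreal_ofReal
  have hE : 0 ≤ ∫ x, (overshoot c x) ^ 2 ∂(gridLaw X P k 1) := integral_nonneg fun x ↦ by positivity
  unfold gridBound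
  rw [lintegral_add_left measurable_const,
    lintegral_finsetSum' _ fun j _ ↦ (hm j).const_mul 2]
  · rw [ENNReal.ofReal_add (by positivity) (by positivity)]
    simp only [lintegral_const, measure_univ, mul_one]
    gcongr
    calc _ ≤ ∑ j ∈ Finset.range k,
          2 * ENNReal.ofReal (4 * ∫ x, (overshoot c x) ^ 2 ∂(gridLaw X P k 1)) := by
          refine Finset.sum_le_sum fun j _ ↦ ?_
          rw [lintegral_const_mul'' _ (hm j)]
          gcongr
          exact hX.lintegral_blockOvershoot_sq_le h4 h1 h2 hc hk hn j
      _ = _ := by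
          rw [Finset.sum_const, Finset.card_range, nsmul_eq_mul]
          have e2 : (2 : ℝ≥0∞) = ENNReal.ofReal 2 := by simp
          rw [e2, ← ENNReal.ofReal_natCast k, ← ENNReal.ofReal_mul (by norm_num),
            ← ENNReal.ofReal_mul (by positivity)]
          ring_nf

/-- The oscillation of a centred Lévy process of unit variance over intervals of length `1 / k`, in
terms of overshoots of a single increment over an arbitrary level `c`. -/
lemma IsLevyProcess.lintegral_iSup_sq_le (hX : IsLevyProcess X P)
    (h4 : Integrable (fun x : ℝ ↦ x ^ 4) (P.map (X 1))) (h1 : ∫ x, x ∂(P.map (X 1)) = 0)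
    (h2 : ∫ x, x ^ 2 ∂(P.map (X 1)) = 1) {c : ℝ} (hc : 0 ≤ c) {k : ℕ} (hk : k ≠ 0) :
    ∫⁻ ω, ⨆ t ∈ Set.Icc (0 : ℝ≥0) 1,
        ENNReal.ofReal ((X t ω - discretize k (fun s ↦ X s ω) t) ^ 2) ∂P
      ≤ ENNReal.ofReal (2 * c ^ 2 + 8 * k * ∫ x, (overshoot c x) ^ 2 ∂(gridLaw X P k 1)) := by
  have hm : ∀ n : ℕ, AEMeasurable (gridBound X c k (n + 1)) P := fun n ↦ by
    unfold gridBound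
    have h (j : ℕ) :
        AEMeasurable (fun ω ↦ 2 * ENNReal.ofReal (blockOvershoot X c k (n + 1) j ω ^ 2)) P :=
      ((aemeasurable_blockOvershoot hX c k (n + 1) j).pow_const 2).ennreal_ofReal.const_mul 2
    fun_prop
  -- The uncountable supremum enters only through monotonicity of the integral, which needs no
  -- measurability; Fatou's lemma is applied to the grid bounds.
  calc _ ≤ ∫⁻ ω, liminf (fun n : ℕ ↦ gridBound X c k (n + 1) ω) atTop ∂P := by
        refine lintegral_mono_ae ?_
        filter_upwards [hX.cadlag] with ω hω
        exact iSup₂_le fun t ht ↦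
          ofReal_sq_sub_discretize_le_liminf (fun s ↦ (hω s).1) c hk ht.2
    _ ≤ liminf (fun n : ℕ ↦ ∫⁻ ω, gridBound X c k (n + 1) ω ∂P) atTop := lintegral_liminf_le' hm
    _ ≤ liminf (fun _ : ℕ ↦ ENNReal.ofReal (2 * c ^ 2
          + 8 * k * ∫ x, (overshoot c x) ^ 2 ∂(gridLaw X P k 1))) atTop :=
        liminf_le_liminf (Eventually.of_forall fun n ↦
          hX.lintegral_gridBound_le h4 h1 h2 hc hk n.succ_ne_zero)
    _ = _ := liminf_const _

end Paths

/-! ### Choice of the level and conclusion. -/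

theorem proposition2p7 :
    ∃ C : ℝ, 0 < C ∧
      ∀ (Ω : Type*) [MeasurableSpace Ω] (P : Measure Ω) [IsProbabilityMeasure P]
        (X : ℝ≥0 → Ω → ℝ), IsLevyProcess X P →
        ∫ ω, X 1 ω ∂P = 0 → ∫ ω, (X 1 ω) ^ 2 ∂P = 1 → MemLp (X 1) 4 P →
        ∀ k : ℕ, 2 ≤ k →
          ∫⁻ ω, ⨆ t ∈ Set.Icc (0 : ℝ≥0) 1,
              ENNReal.ofReal ((X t ω - discretize k (fun s ↦ X s ω) t) ^ 2) ∂P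
            ≤ ENNReal.ofReal C *
              ((k : ℝ≥0∞) * levyFourthMoment X P + ENNReal.ofReal (Real.log k / k)) := by
  -- The case `k κ ≤ 1` costs `2288 k κ + (40 + 2 * 2288) log k / k`, where `1 / k ≤ 2 log k / k`;
  -- the largest coefficient is `4616`.
  refine ⟨5000, by norm_num, fun Ω _ P _ X hX hm1 hm2 hm4 k hk ↦ ?_⟩
  have hk' : k ≠ 0 := by omega
  have hk0 : (0 : ℝ) < k := by positivity
  have hp := hX.isProbabilityMeasure_map
  have hX1 := hX.aemeasurable 1
  have h1 : ∫ x, x ∂(P.map (X 1)) = 0 := by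
    rw [integral_map hX1 (by fun_prop)]; exact hm1
  have h2 : ∫ x, x ^ 2 ∂(P.map (X 1)) = 1 := by
    rw [integral_map hX1 (by fun_prop)]; exact hm2
  have h4 : Integrable (fun x : ℝ ↦ x ^ 4) (P.map (X 1)) := by
    rw [integrable_map_measure (by fun_prop) hX1]
    have := MemLp.integrable_norm_pow (p := 4) (by exact_mod_cast hm4) (by norm_num)
    refine this.congr (ae_of_all _ fun ω ↦ ?_)
    simp [Even.pow_abs (show Even 4 by decide)]
  have hle := hX.ofReal_fourth_cumulant_le h4 h1 h2
  have hκ0 := hX.fourth_cumulant_nonneg h4 h1 h2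
  set κ : ℝ := ∫ x, x ^ 4 ∂(P.map (X 1)) - 3 with hκ
  have hlog : 1 / 2 ≤ Real.log k := by
    have h1 := Real.log_two_gt_d9
    have h2 : Real.log 2 ≤ Real.log k := Real.log_le_log (by norm_num) (by exact_mod_cast hk)
    linarith
  have hlk : 0 ≤ Real.log k / k := div_nonneg (by linarith) hk0.le
  suffices h : ∃ c : ℝ, 0 ≤ c ∧ 2 * c ^ 2 + 8 * k * ∫ x, (overshoot c x) ^ 2 ∂(gridLaw X P k 1)
      ≤ 5000 * (k * κ + Real.log k / k) by
    obtain ⟨c, hc, h⟩ := h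
    calc _ ≤ _ := hX.lintegral_iSup_sq_le h4 h1 h2 hc hk'
      _ ≤ ENNReal.ofReal (5000 * (k * κ + Real.log k / k)) := ENNReal.ofReal_le_ofReal h
      _ = ENNReal.ofReal 5000 * (k * ENNReal.ofReal κ + ENNReal.ofReal (Real.log k / k)) := by
          rw [ENNReal.ofReal_mul (by norm_num), ENNReal.ofReal_add (by positivity) hlk,
            ENNReal.ofReal_mul hk0.le, ENNReal.ofReal_natCast]
      _ ≤ _ := by gcongr
  rcases le_total (k * κ) 1 with hkκ | hkκ
  · refine ⟨(2 + √(2 * Real.log k)) * (1 / √k), by positivity, ?_⟩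
    have hE := hX.integral_overshoot_sq_le h4 h1 h2 hk hkκ rfl rfl
    have hc2 : 2 * ((2 + √(2 * Real.log k)) * (1 / √k)) ^ 2 ≤ 40 * (Real.log k / k) := by
      rw [mul_pow, div_pow, Real.sq_sqrt hk0.le, one_pow]
      have hs := Real.sq_sqrt (show 0 ≤ 2 * Real.log k by linarith)
      have : (2 + √(2 * Real.log k)) ^ 2 ≤ 20 * Real.log k := by
        nlinarith [sq_nonneg (2 - √(2 * Real.log k))]
      calc _ ≤ 2 * (20 * Real.log k * (1 / k)) := by gcongr
        _ = _ := by ring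
    have hE2 : 8 * k * ∫ x, (overshoot ((2 + √(2 * Real.log k)) * (1 / √k)) x) ^ 2
          ∂(gridLaw X P k 1) ≤ 8 * k * (286 * (κ + 1 / k ^ 2)) := by gcongr
    have e : 8 * k * (286 * (κ + 1 / (k : ℝ) ^ 2)) = 2288 * (k * κ) + 2288 * (1 / k) := by
      field_simp; ring
    have hinv : 1 / (k : ℝ) ≤ 2 * (Real.log k / k) := by
      rw [← mul_div_assoc]; gcongr; linarith
    have : 0 ≤ k * κ := by positivity
    linarith
  -- At level `0` the bound is `8 k * (1 / k) = 8`, which `5000 k κ` exceeds.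
  · refine ⟨0, le_rfl, ?_⟩
    have e : ∀ x, (overshoot 0 x) ^ 2 = x ^ 2 := fun x ↦ by
      unfold overshoot
      rw [sub_zero, max_eq_left (abs_nonneg x), sq_abs]
    simp_rw [e]
    rw [(hX.moments_gridLaw_one h4 h1 h2 hk').2.1]
    have : 8 * k * (1 / (k : ℝ)) = 8 := by field_simp
    rw [this]
    linarith
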